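/- Let $L/K$ be a cyclic field extension (that is, finite Galois with cyclic Galois group) of squarefree degree $n$, and let $G$ be any group of order $n$. Let $z=|Z(G)|$ be the order of the centre of $G$ and let $g=|G'|$ be the order of its commutator subgroup. Then $gz$ divides $n$; put $d=n/(gz)$. A Hopf-Galois structure on $L/K$ is a cocommutative $K$-Hopf algebra $H$ together with a $K$-linear action of $H$ on $L$ making $L$ an $H$-module algebra, that is, $h\cdot(xy)=\sum_{(h)}(h_{(1)}\cdot x)(h_{(2)}\cdot y)$ and $h\cdot k=\epsilon(h)k$ for $h\in H$, $x,y\in L$, $k\in K$, such that the map $\theta\colon L\otimes_K L\to \operatorname{Hom}_K(H,L)$, $\theta(x\otimes y)(h)=x(h\cdot y)$, is bijective. Two Hopf-Galois structures are identified if there is an isomorphism between their Hopf algebras which is compatible with the actions on $L$. A Hopf-Galois structure has type $G$ if $L\otimes_K H\cong L[G]$ as $L$-Hopf algebras. Then $L/K$ admits precisely $2^{\omega(g)}\varphi(d)$ Hopf-Galois structures of type $G$, where $\omega(g)$ is the number of distinct prime factors of $g$ and $\varphi$ is Euler's totient function. In particular, at least one Hopf-Galois structure of type $G$ exists on $L/K$,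 so every group of order $n$ occurs as a type. -/

import Mathlib

open scoped TensorProduct

universe u v w

/-- A Hopf-Galois structure on a field extension `L/K`: a cocommutative `K`-Hopf algebra `H`
(`carrier`) with a `K`-linear action on `L` (`act`) making `L` an `H`-module algebra, such that
`θ : L ⊗ L → Hom_K(H, L)`, `θ (x ⊗ y) h = x * (h · y)`, is bijective. When `[L : K]` is finite,
bijectivity of `θ` forces `dim_K H = [L : K]`, so every such `H` has an isomorphic
copy in the universe of `L`. -/
structure HopfGaloisStructure (K : Type u) (L : Type v) [Field K] [Field L] [Algebra K L] where
  /-- The underlying type of the Hopf algebra `H`. -/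
  carrier : Type v
  [ring : Ring carrier]
  [hopfAlgebra : HopfAlgebra K carrier]
  [isCocomm : Coalgebra.IsCocomm K carrier]
  /-- The action of `H` on `L`; `act h x` is `h · x`. -/
  act : carrier →ₐ[K] Module.End K L
  /-- `h · (x * y) = ∑ (h₁ · x) * (h₂ · y)`. -/
  act_mul : ∀ (h : carrier) (x y : L),
    act h (x * y) =
      LinearMap.mul' K L
        (TensorProduct.map (act.toLinearMap.flip x) (act.toLinearMap.flip y)
          (Coalgebra.comul (R := K) h))
  /-- `h · k = ε(h) k` for `k` in `K`. -/
  act_algebraMap : ∀ (h : carrier) (k : K),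
    act h (algebraMap K L k) = algebraMap K L (Coalgebra.counit (R := K) h * k)
  /-- `θ` is bijective. -/
  bijective_theta : Function.Bijective
    (TensorProduct.lift
      (LinearMap.mk₂ K
        (fun x y : L => LinearMap.mulLeft K x ∘ₗ act.toLinearMap.flip y)
        (fun _ _ _ => by ext; simp [add_mul])
        (fun _ _ _ => by ext; simp)
        (fun _ _ _ => by ext; simp [mul_add])
        (fun _ _ _ => by ext; simp)) : L ⊗[K] L →ₗ[K] (carrier →ₗ[K] L))

namespace HopfGaloisStructure

attribute [instance] ring hopfAlgebra isCocomm

variable {K : Type u} {L : Type v} [Field K] [Field L] [Algebra K L]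

/-- Two Hopf-Galois structures on `L/K` are identified when some isomorphism of the Hopf algebras
is compatible with their actions on `L`. (A bialgebra isomorphism between Hopf algebras preserves
the antipodes.) -/
def Equivalent (S T : HopfGaloisStructure K L) : Prop :=
  ∃ e : S.carrier ≃ₐc[K] T.carrier, ∀ (h : S.carrier) (x : L), T.act (e h) x = S.act h x

/-- A Hopf-Galois structure has type `G` if its Hopf algebra `H` becomes isomorphic to the group
algebra `L[G]` after extension of scalars to `L`: `L ⊗ H ≃ L[G]` as `L`-Hopf algebras. -/
def IsOfType (S : HopfGaloisStructure K L) (G : Type w) [Group G] : Prop :=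
  Nonempty (L ⊗[K] S.carrier ≃ₐc[L] MonoidAlgebra L G)

variable (K L)

/-- The equivalence relation `Equivalent` as a setoid. -/
def setoid : Setoid (HopfGaloisStructure K L) where
  r := Equivalent
  iseqv :=
    { refl := fun S => ⟨BialgEquiv.refl K S.carrier, fun _ _ => rfl⟩
      symm := by
        rintro S T ⟨e, he⟩
        refine ⟨e.symm, fun h x => ?_⟩
        rw [← he (e.symm h) x]
        exact congrArg (fun t => T.act t x) (e.toEquiv.apply_symm_apply h)
      trans := by
        rintro S T U ⟨e, he⟩ ⟨f, hf⟩
        exact ⟨e.trans f, fun h x => (hf (e h) x).trans (he h x)⟩ }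

/-- The Hopf-Galois structures of type `G` on `L/K`, up to equivalence. -/
def OfType (G : Type w) [Group G] : Type (max u (v + 1)) :=
  Quotient ((setoid K L).comap
    (Subtype.val : {S : HopfGaloisStructure K L // S.IsOfType G} → HopfGaloisStructure K L))

end HopfGaloisStructure

/-! Let Γ be the Galois group of `L/K`. By Galois descent, Hopf-Galois structures of type `G` amount
to bijective crossed homomorphisms Γ → G, up to Aut G; this is `ofTypeEquiv`, which holds for every
finite Galois extension. After base change to `L` the Hopf algebra `H` becomes `L[G]`. Its
group-like elements are the elements of `G`, and they act on `L` as automorphisms, which gives a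
bijection φ : Γ ≃ G. The Galois action on the scalars of `L ⊗ H` permutes the group-likes by
automorphisms of `G`, and its compatibility with the action on `L` is the crossed-homomorphism
identity. Conversely, `H` is recovered as the fixed points of the twisted action on `L[G]`.

It remains to count. In a group of squarefree order all Sylow subgroups are cyclic, so G' = {j(x) :
x ∈ ℤ/g} and G/G' are cyclic, the latter of order m = n/g. Any `a` generating `G` modulo G'
satisfies a^m = 1 and acts on G' by multiplication by some κ with κ - 1 a unit mod g. Let σ generate
Γ, put a = φ(σ), and let α be the automorphism attached to σ. An affine map on a cyclic group of
squarefree order with a single orbit is a translation, so α is trivial on G/G' and α(a) = j(t)a. If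
α acts on G' by u, then φ(σ^i) = j(t S_i) a^i, where S_i is an iterated geometric sum in κ and u
(`eq_j_mul_pow`).

Bijectivity forces t to be a unit and (u - 1)(uκ - 1) = 0 (`isUnit_of_isCocycle`), and every such
pair (κ, u) occurs (`exists_cocycle_of_parameters`). Automorphisms of `G` absorb t, so (κ, u) is a
complete invariant. Here κ is any generator of the image of `G` in (ℤ/g)ˣ; that image is cyclic of
order d because the centre is generated by a^d, so there are φ(d) choices of κ. Modulo each prime
dividing g, u is 1 or κ⁻¹, which differ because κ - 1 is a unit: 2^ω(g) choices of u. -/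

/-- A bijective crossed homomorphism. -/
def IsCocycle {Γ : Type*} {G : Type*} [Group Γ] [Group G] (φ : Γ ≃ G) : Prop :=
  ∀ γ, ∃ f : MulAut G, ∀ δ, φ (γ * δ) = φ γ * f (φ δ)

namespace IsCocycle

variable {Γ : Type*} {G : Type*} [Group Γ] [Group G] {φ : Γ ≃ G}

theorem map_one (h : IsCocycle φ) : φ 1 = 1 := by
  obtain ⟨f, hf⟩ := h 1
  have h1 := hf (φ.symm 1)
  simpa using h1.symm

/-- The action underlying a bijective crossed homomorphism. -/
noncomputable def action (h : IsCocycle φ) : Γ →* MulAut G :=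
  MonoidHom.mk' (fun γ => (h γ).choose) <| fun γ γ' => by
    ext x
    obtain ⟨δ, rfl⟩ := φ.surjective x
    refine mul_left_cancel (a := φ (γ * γ')) ?_
    rw [← (h (γ * γ')).choose_spec δ, mul_assoc, (h γ).choose_spec, (h γ').choose_spec,
      (h γ).choose_spec γ', _root_.map_mul, mul_assoc]
    rfl

theorem map_mul (h : IsCocycle φ) (γ δ : Γ) : φ (γ * δ) = φ γ * h.action γ (φ δ) :=
  (h γ).choose_spec δ

theorem symm_mul (h : IsCocycle φ) (g k : G) :
    φ.symm (g * h.action (φ.symm g) k) = φ.symm g * φ.symm k := by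
  rw [Equiv.symm_apply_eq, h.map_mul]; simp

end IsCocycle

/-! ### Dual bases of the trace form -/

section Trace

variable (K : Type u) (L : Type v) [Field K] [Field L] [Algebra K L] [FiniteDimensional K L]
  [IsGalois K L]

open Classical in
/-- Dual bases for the trace form, in terms of the Galois group. -/
theorem exists_galois_dual : ∃ (n : ℕ) (b m : Fin n → L), ∀ γ : L ≃ₐ[K] L,
    ∑ i, γ (b i) * m i = if γ = 1 then 1 else 0 := by
  let b := Module.finBasis K L
  let m := (Algebra.traceForm K L).dualBasis (traceForm_nondegenerate K L) b
  refine ⟨_, b, m, fun γ₀ => ?_⟩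
  -- The expansion x = ∑ Tr(x b_i) m_i, with the trace written as a sum over the Galois group, is a
  -- linear relation between automorphisms; Dedekind independence then gives the coefficients.
  have key : ∀ x : L, ∑ γ : L ≃ₐ[K] L, (∑ i, γ (b i) * m i - if γ = 1 then 1 else 0) * γ x = 0 := by
    intro x
    have h1 : ∑ i, algebraMap K L (Algebra.trace K L (x * b i)) * m i = x := by
      have h2 := m.sum_repr x
      simp only [m, LinearMap.BilinForm.dualBasis_repr_apply, Algebra.traceForm_apply] at h2
      simpa [Algebra.smul_def] using h2
    simp only [trace_eq_sum_automorphisms, Finset.sum_mul, _root_.map_mul] at h1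
    rw [Finset.sum_comm] at h1
    simp only [sub_mul, Finset.sum_sub_distrib, Finset.sum_mul]
    simp only [ite_mul, one_mul, zero_mul, Finset.sum_ite_eq', Finset.mem_univ, if_true,
      AlgEquiv.one_apply, sub_eq_zero]
    conv_rhs => rw [← h1]
    exact Finset.sum_congr rfl fun γ _ => Finset.sum_congr rfl fun i _ => by ring
  have li := (linearIndependent_monoidHom L L).comp
    (fun γ : L ≃ₐ[K] L => ((γ : L →+* L) : L →* L))
    (fun γ γ' h => AlgEquiv.ext fun x => DFunLike.congr_fun h x)
  rw [Fintype.linearIndependent_iff] at li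
  have := li (fun γ => ∑ i, γ (b i) * m i - if γ = 1 then 1 else 0)
    (by ext x; simpa using key x) γ₀
  exact sub_eq_zero.mp this

end Trace

-- Applying δ to the duality relation for δ⁻¹γ: the matrices (γ b_i) and (δ m_i) are inverse to each
-- other, which isolates single terms of sums over the Galois group.
open Classical in
theorem galois_dual_pair {K : Type u} {L : Type v} [Field K] [Field L] [Algebra K L]
    {n : ℕ} {b m : Fin n → L} (hbm : ∀ γ : L ≃ₐ[K] L,
    ∑ i, γ (b i) * m i = if γ = 1 then 1 else 0) (γ δ : L ≃ₐ[K] L) :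
    ∑ i, γ (b i) * δ (m i) = if γ = δ then 1 else 0 := by
  have h := congrArg δ (hbm (δ⁻¹ * γ))
  simp only [map_sum, _root_.map_mul, AlgEquiv.mul_apply] at h
  rw [apply_ite δ] at h
  simp only [map_one, map_zero, inv_mul_eq_one, eq_comm (a := δ)] at h
  rw [← h]
  exact Finset.sum_congr rfl fun i _ => by
    congr 1; exact (AlgEquiv.apply_symm_apply δ _).symm

/-! ### Galois descent for the twisted group algebra -/

namespace GaloisDescent

variable {K : Type u} {L : Type v} [Field K] [Field L] [Algebra K L]
  {G : Type v} [Group G] (ρ : (L ≃ₐ[K] L) →* MulAut G)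

/-- The semilinear action on the group algebra `L[G]` twisted by an action on `G`. -/
noncomputable def twist (γ : L ≃ₐ[K] L) : MonoidAlgebra L G →ₐ[K] MonoidAlgebra L G :=
  (MonoidAlgebra.mapAlgHom G (γ : L →ₐ[K] L)).comp
    (MonoidAlgebra.mapDomainAlgHom K L ((ρ γ : G ≃* G) : G →* G))

@[simp] theorem twist_single (γ : L ≃ₐ[K] L) (g : G) (l : L) :
    twist ρ γ (MonoidAlgebra.single g l) = MonoidAlgebra.single (ρ γ g) (γ l) := by
  simp [twist]

theorem twist_smul (γ : L ≃ₐ[K] L) (l : L) (x : MonoidAlgebra L G) :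
    twist ρ γ (l • x) = γ l • twist ρ γ x := by
  induction x using MonoidAlgebra.induction_linear <;> simp_all

theorem twist_mul (γ δ : L ≃ₐ[K] L) (x : MonoidAlgebra L G) :
    twist ρ (γ * δ) x = twist ρ γ (twist ρ δ x) := by
  induction x using MonoidAlgebra.induction_linear <;> simp_all

/-- The fixed points of the twisted action on `L[G]`. -/
noncomputable def fixed : Subalgebra K (MonoidAlgebra L G) :=
  ⨅ γ, AlgHom.equalizer (twist ρ γ) (AlgHom.id K _)

theorem mem_fixed {x : MonoidAlgebra L G} : x ∈ fixed ρ ↔ ∀ γ, twist ρ γ x = x := by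
  simp [fixed, Algebra.mem_iInf, AlgHom.mem_equalizer]

variable [FiniteDimensional K L]

/-- The sum over the orbit under the twisted action. -/
noncomputable def orbitSum (x : MonoidAlgebra L G) : fixed ρ :=
  ⟨∑ γ, twist ρ γ x, (mem_fixed ρ).2 fun δ => by
    simp only [map_sum, ← twist_mul]
    exact Fintype.sum_equiv (Equiv.mulLeft δ) _ _ fun γ => rfl⟩

theorem coe_orbitSum (x : MonoidAlgebra L G) : (orbitSum ρ x : MonoidAlgebra L G) = ∑ γ, twist ρ γ x := rfl

variable [IsGalois K L]

theorem coe_orbitSum_smul (l : L) (x : fixed ρ) :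
    (orbitSum ρ (l • (x : MonoidAlgebra L G)) : MonoidAlgebra L G) = Algebra.trace K L l • (x : MonoidAlgebra L G) := by
  rw [coe_orbitSum, algebra_compatible_smul L (Algebra.trace K L l), trace_eq_sum_automorphisms, Finset.sum_smul]
  exact Finset.sum_congr rfl fun γ _ => by rw [twist_smul, (mem_fixed ρ).1 x.2]

/-- Elements of `fixed ρ` are sums of orbit sums of monomials. -/
theorem fixed_induction {p : fixed ρ → Prop} (hadd : ∀ x y, p x → p y → p (x + y)) (h0 : p 0)
    (hs : ∀ g l, p (orbitSum ρ (MonoidAlgebra.single g l))) (x : fixed ρ) : p x := by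
  have hadd' (a b) : orbitSum ρ (a + b) = orbitSum ρ a + orbitSum ρ b := by
    ext1; simp [coe_orbitSum, Finset.sum_add_distrib]
  have h0' : orbitSum ρ 0 = 0 := by ext1; simp [coe_orbitSum]
  have hall : ∀ y, p (orbitSum ρ y) := fun y => by
    induction y using MonoidAlgebra.induction_linear with
    | zero => rwa [h0']
    | add a b ha hb => rw [hadd']; exact hadd _ _ ha hb
    | single a l => exact hs a l
  -- With Tr l = 1, the orbit sum of l • x is x itself, so orbit sums exhaust the fixed points.
  obtain ⟨l, hl⟩ := Algebra.trace_surjective K L 1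
  have : orbitSum ρ (l • (x : MonoidAlgebra L G)) = x := by
    ext1; rw [coe_orbitSum_smul, hl, one_smul]
  rw [← this]; exact hall _

/-- A monomial is an `L`-combination of orbit sums: weighting the orbit sums of b_i g by the dual
basis m_i cancels every conjugate except that of γ = 1. -/
theorem span_fixed : Submodule.span L (fixed ρ : Set (MonoidAlgebra L G)) = ⊤ := by
  classical
  rw [eq_top_iff]
  rintro x -
  induction x using MonoidAlgebra.induction_linear with
  | zero => exact zero_mem _
  | add a b ha hb => exact add_mem ha hb
  | single g l =>
    obtain ⟨n, b, m, hbm⟩ := exists_galois_dual K L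
    have : MonoidAlgebra.single g l =
        ∑ i, (l * m i) • (orbitSum ρ (MonoidAlgebra.single g (b i)) : MonoidAlgebra L G) := by
      simp only [coe_orbitSum, twist_single, Finset.smul_sum]
      rw [Finset.sum_comm]
      simp only [MonoidAlgebra.smul_single, smul_eq_mul]
      have h1 (γ : L ≃ₐ[K] L) : ∑ i, MonoidAlgebra.single (ρ γ g) (l * m i * γ (b i)) =
          MonoidAlgebra.single (ρ γ g) (l * if γ = 1 then 1 else 0) := by
        rw [← hbm γ, Finset.mul_sum]
        refine Eq.trans ?_ (map_sum (MonoidAlgebra.singleAddHom (ρ γ g)) _ _).symm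
        exact Finset.sum_congr rfl fun i _ => by rw [mul_assoc, mul_comm (m i)]; rfl
      simp only [h1]
      rw [Finset.sum_eq_single 1]
      · simp
      · intro γ _ hγ; simp [hγ]
      · simp
    rw [this]
    exact Submodule.sum_mem _ fun i _ => Submodule.smul_mem _ _ (Submodule.subset_span (orbitSum ρ _).2)

/-- Multiplying an `L`-relation by x and taking orbit sums gives a `K`-relation with coefficients
Tr(c_j x). These vanish for all x, and the trace form is nondegenerate. -/
theorem linearIndependent_coe {ι : Type*} {b : ι → fixed ρ} (hb : LinearIndependent K b) :
    LinearIndependent L (fun i => (b i : MonoidAlgebra L G)) := by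
  rw [linearIndependent_iff'] at hb ⊢
  intro s c hc i hi
  refine (traceForm_nondegenerate K L).1 (c i) fun x => ?_
  have h1 := hb s (fun j => Algebra.trace K L (c j * x)) ?_ i hi
  · simpa using h1
  · have h2 : ∑ j ∈ s, orbitSum ρ ((c j * x) • (b j : MonoidAlgebra L G)) = 0 := by
      ext1
      simp only [AddSubmonoidClass.coe_finsetSum, coe_orbitSum]
      rw [Finset.sum_comm]
      refine Finset.sum_eq_zero fun γ _ => ?_
      rw [← map_sum]
      have : ∑ j ∈ s, (c j * x) • (b j : MonoidAlgebra L G) = x • ∑ j ∈ s, c j • (b j : MonoidAlgebra L G) := by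
        rw [Finset.smul_sum]
        exact Finset.sum_congr rfl fun j _ => by rw [smul_smul, mul_comm]
      rw [this, hc]; simp
    rw [← h2]
    refine Finset.sum_congr rfl fun j _ => ?_
    ext1
    rw [coe_orbitSum_smul]; rfl

/-- A `K`-basis of the fixed points is an `L`-basis of the group algebra. -/
noncomputable def basisOfFixed {ι : Type*} (b : Module.Basis ι K (fixed ρ)) :
    Module.Basis ι L (MonoidAlgebra L G) :=
  Module.Basis.mk (linearIndependent_coe ρ b.linearIndependent) <| by
    rw [← span_fixed ρ, Submodule.span_le]
    intro x hx
    have := b.mem_span ⟨x, hx⟩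
    have h2 := Submodule.mem_map_of_mem (f := (fixed ρ).val.toLinearMap) this
    rw [Submodule.map_span] at h2
    refine Submodule.span_subset_span K L _ ?_
    convert h2
    rw [← Set.range_comp]; rfl

@[simp] theorem basisOfFixed_apply {ι : Type*} (b : Module.Basis ι K (fixed ρ)) (i : ι) :
    basisOfFixed ρ b i = (b i : MonoidAlgebra L G) := by simp [basisOfFixed]

end GaloisDescent

/-! ### Comparing tensor products over `K` and over `L` -/

section BaseField

variable {K : Type*} {L : Type*} [Field K] [Field L] [Algebra K L]
  {M N M' N' : Type*} [AddCommMonoid M] [AddCommMonoid N] [Module K M] [Module K N]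
  [AddCommGroup M'] [AddCommGroup N'] [Module K M'] [Module K N'] [Module L M'] [Module L N']
  [IsScalarTower K L M'] [IsScalarTower K L N']

/-- The map `m ⊗ n ↦ f m ⊗ g n` from a tensor product over `K` to one over `L`. -/
noncomputable def tensorMapOver (L : Type*) [Field L] [Algebra K L] [Module L M'] [Module L N']
    [IsScalarTower K L M'] [IsScalarTower K L N'] (f : M →ₗ[K] M') (g : N →ₗ[K] N') :
    M ⊗[K] N →ₗ[K] M' ⊗[L] N' :=
  TensorProduct.lift (((TensorProduct.mk L M' N').restrictScalars₁₂ K K).compl₁₂ f g)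

@[simp] theorem tensorMapOver_tmul (f : M →ₗ[K] M') (g : N →ₗ[K] N') (m : M) (n : N) :
    tensorMapOver L f g (m ⊗ₜ n) = f m ⊗ₜ g n := rfl

theorem linearIndependent_tensorMapOver {ι κ : Type*} {f : M →ₗ[K] M'} {g : N →ₗ[K] N'}
    (b : Module.Basis ι K M) (c : Module.Basis κ K N) (hb : LinearIndependent L (f ∘ b))
    (hc : LinearIndependent L (g ∘ c)) :
    LinearIndependent L (tensorMapOver L f g ∘ b.tensorProduct c) := by
  have h := hb.tmul_of_flat_left hc
  have e : tensorMapOver L f g ∘ b.tensorProduct c =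
      fun i : ι × κ => (f ∘ b) i.1 ⊗ₜ[L] (g ∘ c) i.2 := by
    ext i; simp [Module.Basis.tensorProduct_apply']
  rwa [e]

theorem injective_of_linearIndependent_comp {ι : Type*} {f : M →ₗ[K] M'} (b : Module.Basis ι K M)
    (hb : LinearIndependent L (f ∘ b)) : Function.Injective f := by
  have h := hb.restrict_scalars (R := K) (by
    simpa [Algebra.smul_def] using (algebraMap K L).injective)
  intro x y hxy
  rw [← b.linearCombination_repr x, ← b.linearCombination_repr y, Finsupp.apply_linearCombination,
    Finsupp.apply_linearCombination] at hxy
  exact b.repr.injective (h hxy)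

theorem comul_one_tmul {C : Type*} [AddCommGroup C] [Module K C] [Coalgebra K C] (c : C) :
    Coalgebra.comul (R := L) ((1 : L) ⊗ₜ[K] c) =
      tensorMapOver L (TensorProduct.mk K L C 1) (TensorProduct.mk K L C 1)
        (Coalgebra.comul (R := K) c) := by
  rw [TensorProduct.comul_tmul, CommSemiring.comul_apply]
  induction Coalgebra.comul (R := K) c with
  | zero => simp
  | add a b ha hb => rw [TensorProduct.tmul_add, map_add, ha, hb, map_add]
  | tmul a b => simp

end BaseField

/-! ### The Hopf algebra of fixed points -/

namespace GaloisDescent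

open scoped MonoidAlgebra
open Coalgebra

variable {K : Type u} {L : Type v} [Field K] [Field L] [Algebra K L]
  {G : Type v} [Group G] (ρ : (L ≃ₐ[K] L) →* MulAut G)

/-- The map from the tensor square of the fixed points to that of the group algebra. -/
noncomputable def squareMap : fixed ρ ⊗[K] fixed ρ →ₐ[K] L[G] ⊗[L] L[G] :=
  Algebra.TensorProduct.lift
    (((Algebra.TensorProduct.includeLeft : L[G] →ₐ[L] L[G] ⊗[L] L[G]).restrictScalars K).comp
      (fixed ρ).val)
    (((Algebra.TensorProduct.includeRight : L[G] →ₐ[L] L[G] ⊗[L] L[G]).restrictScalars K).comp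
      (fixed ρ).val)
    (fun x y => by simp [commute_iff_eq])

@[simp] theorem squareMap_tmul (x y : fixed ρ) :
    squareMap ρ (x ⊗ₜ y) = (x : L[G]) ⊗ₜ (y : L[G]) :=
  (Algebra.TensorProduct.lift_tmul _ _ _ _ _).trans (by simp)

theorem squareMap_toLinearMap : (squareMap ρ).toLinearMap =
    tensorMapOver L (fixed ρ).val.toLinearMap (fixed ρ).val.toLinearMap := by
  ext; simp

/-- The map from the tensor cube of the fixed points to that of the group algebra. -/
noncomputable def cubeMap :
    fixed ρ ⊗[K] (fixed ρ ⊗[K] fixed ρ) →ₗ[K] L[G] ⊗[L] (L[G] ⊗[L] L[G]) :=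
  tensorMapOver L (fixed ρ).val.toLinearMap (squareMap ρ).toLinearMap

@[simp] theorem cubeMap_tmul (x : fixed ρ) (y : fixed ρ ⊗[K] fixed ρ) :
    cubeMap ρ (x ⊗ₜ y) = (x : L[G]) ⊗ₜ squareMap ρ y := rfl

/-- The natural map from the base change of the fixed points to the group algebra. -/
noncomputable def baseChangeHom : L ⊗[K] fixed ρ →ₐ[L] L[G] :=
  Algebra.TensorProduct.lift (Algebra.ofId L L[G]) (fixed ρ).val (fun l _ => Algebra.commutes l _)

@[simp] theorem baseChangeHom_tmul (l : L) (x : fixed ρ) :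
    baseChangeHom ρ (l ⊗ₜ x) = l • (x : L[G]) :=
  (Algebra.TensorProduct.lift_tmul _ _ _ _ _).trans (Algebra.smul_def _ _).symm

variable [FiniteDimensional K L] [IsGalois K L]

/-- This and `cubeMap_injective` allow the Hopf algebra axioms for the fixed points to be verified
inside tensor powers of `L[G]`. -/
theorem squareMap_injective : Function.Injective (squareMap ρ) := by
  let b := Module.Basis.ofVectorSpace K (fixed ρ)
  have h1 := linearIndependent_coe ρ b.linearIndependent
  have := injective_of_linearIndependent_comp _ (linearIndependent_tensorMapOver
    (f := (fixed ρ).val.toLinearMap) (g := (fixed ρ).val.toLinearMap) b b h1 h1)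
  rwa [← squareMap_toLinearMap] at this

theorem cubeMap_injective : Function.Injective (cubeMap ρ) := by
  let b := Module.Basis.ofVectorSpace K (fixed ρ)
  have h1 := linearIndependent_coe ρ b.linearIndependent
  have h2 := linearIndependent_tensorMapOver
    (f := (fixed ρ).val.toLinearMap) (g := (fixed ρ).val.toLinearMap) b b h1 h1
  rw [← squareMap_toLinearMap] at h2
  exact injective_of_linearIndependent_comp _ (linearIndependent_tensorMapOver
    (f := (fixed ρ).val.toLinearMap) b (b.tensorProduct b) h1 h2)

/-- For the orbit sum of l g, the tensors built from l b_i and m_i expand into a double sum over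
pairs (δ, γ). Duality of the bases kills all pairs with δ ≠ γ, and the diagonal is the
comultiplication. -/
theorem comul_mem_range (x : fixed ρ) :
    comul (R := L) (x : L[G]) ∈ (squareMap ρ).range := by
  classical
  induction x using fixed_induction with
  | hadd x y hx hy => simpa using add_mem hx hy
  | h0 => simp
  | hs g l =>
    obtain ⟨n, b, m, hbm⟩ := exists_galois_dual K L
    refine ⟨∑ i, orbitSum ρ (MonoidAlgebra.single g (l * b i)) ⊗ₜ
      orbitSum ρ (MonoidAlgebra.single g (m i)), ?_⟩
    have hs (k : G) (r : L) : (MonoidAlgebra.single k r : L[G]) = r • MonoidAlgebra.single k 1 := by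
      simp
    change squareMap ρ _ = _
    simp only [map_sum, squareMap_tmul, coe_orbitSum, twist_single, TensorProduct.sum_tmul,
      TensorProduct.tmul_sum, MonoidAlgebra.comul_single, CommSemiring.comul_apply,
      TensorProduct.map_tmul, MonoidAlgebra.lsingle_apply]
    rw [Finset.sum_comm]
    refine Finset.sum_congr rfl fun γ _ => ?_
    rw [Finset.sum_comm]
    have h1 (δ : L ≃ₐ[K] L) : ∑ i, (MonoidAlgebra.single (ρ δ g) (δ (l * b i)) : L[G]) ⊗ₜ[L]
        (MonoidAlgebra.single (ρ γ g) (γ (m i)) : L[G]) =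
        (δ l * if δ = γ then 1 else 0) • ((MonoidAlgebra.single (ρ δ g) 1 : L[G]) ⊗ₜ[L]
          (MonoidAlgebra.single (ρ γ g) 1 : L[G])) := by
      rw [← galois_dual_pair hbm, Finset.mul_sum, Finset.sum_smul]
      refine Finset.sum_congr rfl fun i _ => ?_
      rw [hs, hs (ρ γ g), TensorProduct.smul_tmul_smul, map_mul, mul_assoc]
    simp only [h1]
    rw [Finset.sum_eq_single γ]
    · rw [hs _ (γ l), TensorProduct.tmul_smul]; simp
    · intro δ _ hδ; simp [hδ]
    · simp

theorem counit_mem_range (x : fixed ρ) :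
    counit (R := L) (x : L[G]) ∈ (⊥ : Subalgebra K L) := by
  induction x using fixed_induction with
  | hadd x y hx hy => simpa using add_mem hx hy
  | h0 => simp
  | hs g l =>
    rw [Algebra.mem_bot]
    refine ⟨Algebra.trace K L l, ?_⟩
    simp [coe_orbitSum, trace_eq_sum_automorphisms]

/-- The comultiplication on the fixed points. -/
noncomputable def comulHom : fixed ρ →ₐ[K] fixed ρ ⊗[K] fixed ρ :=
  (AlgEquiv.ofInjective (squareMap ρ) (squareMap_injective ρ)).symm.toAlgHom.comp
    ((((Bialgebra.comulAlgHom L L[G]).restrictScalars K).comp (fixed ρ).val).codRestrict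
      (squareMap ρ).range (comul_mem_range ρ))

theorem squareMap_comulHom (x : fixed ρ) :
    squareMap ρ (comulHom ρ x) = comul (R := L) (x : L[G]) := by
  have := AlgEquiv.apply_symm_apply (AlgEquiv.ofInjective (squareMap ρ) (squareMap_injective ρ))
    ⟨_, comul_mem_range ρ x⟩
  exact congrArg Subtype.val this

/-- The counit on the fixed points. -/
noncomputable def counitHom : fixed ρ →ₐ[K] K :=
  (Algebra.botEquiv K L).toAlgHom.comp
    ((((Bialgebra.counitAlgHom L L[G]).restrictScalars K).comp (fixed ρ).val).codRestrict
      ⊥ (counit_mem_range ρ))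

theorem algebraMap_counitHom (x : fixed ρ) :
    algebraMap K L (counitHom ρ x) = counit (R := L) (x : L[G]) := by
  have h := (Algebra.botEquiv K L).symm_apply_apply ⟨_, counit_mem_range ρ x⟩
  have h2 := congrArg Subtype.val h
  rwa [Algebra.botEquiv_symm_apply] at h2

noncomputable instance : Bialgebra K (fixed ρ) :=
  Bialgebra.ofAlgHom (comulHom ρ) (counitHom ρ)
    (by
      ext1 x
      apply cubeMap_injective ρ
      have h1 (t : fixed ρ ⊗[K] fixed ρ) : cubeMap ρ (Algebra.TensorProduct.assoc K K K _ _ _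
          (Algebra.TensorProduct.map (comulHom ρ) (.id K _) t)) =
          TensorProduct.assoc L _ _ _ ((comul (R := L) (A := L[G])).rTensor _ (squareMap ρ t)) := by
        induction t with
        | zero => simp
        | add a b ha hb => simp only [map_add, ha, hb]
        | tmul a b =>
          have h2 (s : fixed ρ ⊗[K] fixed ρ) :
              cubeMap ρ (Algebra.TensorProduct.assoc K K K _ _ _ (s ⊗ₜ b)) =
              TensorProduct.assoc L _ _ _ (squareMap ρ s ⊗ₜ (b : L[G])) := by
            induction s with
            | zero => simp
            | add s s' h h' => simp only [map_add, TensorProduct.add_tmul, h, h']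
            | tmul s s' => simp
          simp only [Algebra.TensorProduct.map_tmul, AlgHom.id_apply, h2, squareMap_comulHom]
          simp
      have h3 (t : fixed ρ ⊗[K] fixed ρ) : cubeMap ρ
          (Algebra.TensorProduct.map (.id K _) (comulHom ρ) t) =
          ((comul (R := L) (A := L[G])).lTensor _ (squareMap ρ t)) := by
        induction t with
        | zero => simp
        | add a b ha hb => simp only [map_add, ha, hb]
        | tmul a b => simp [squareMap_comulHom]
      refine (h1 _).trans (Eq.trans ?_ (h3 _).symm)
      refine (congrArg _ (congrArg _ (squareMap_comulHom ρ x))).trans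
        (Eq.trans ?_ (congrArg _ (squareMap_comulHom ρ x)).symm)
      simp)
    (by
      ext1 x
      apply (Algebra.TensorProduct.lid K (fixed ρ)).injective
      ext1
      have h1 (t : fixed ρ ⊗[K] fixed ρ) :
          ((Algebra.TensorProduct.lid K (fixed ρ) (Algebra.TensorProduct.map (counitHom ρ) (.id K _) t) :
            fixed ρ) : L[G]) = TensorProduct.lid L _ ((counit (R := L) (A := L[G])).rTensor _ (squareMap ρ t)) := by
        induction t with
        | zero => simp
        | add a b ha hb => simp only [map_add, ha, hb, Subalgebra.coe_add]
        | tmul a b => simp [← algebraMap_counitHom, algebraMap_smul]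
      refine (h1 _).trans ((congrArg _ (congrArg _ (squareMap_comulHom ρ x))).trans ?_)
      simp)
    (by
      ext1 x
      apply (Algebra.TensorProduct.rid K K (fixed ρ)).injective
      ext1
      have h1 (t : fixed ρ ⊗[K] fixed ρ) :
          ((Algebra.TensorProduct.rid K K (fixed ρ) (Algebra.TensorProduct.map (.id K _) (counitHom ρ) t) :
            fixed ρ) : L[G]) = TensorProduct.rid L _ ((counit (R := L) (A := L[G])).lTensor _ (squareMap ρ t)) := by
        induction t with
        | zero => simp
        | add a b ha hb => simp only [map_add, ha, hb, Subalgebra.coe_add]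
        | tmul a b => simp [← algebraMap_counitHom, algebraMap_smul]
      refine (h1 _).trans ((congrArg _ (congrArg _ (squareMap_comulHom ρ x))).trans ?_)
      simp)

theorem squareMap_comul (x : fixed ρ) :
    squareMap ρ (comul (R := K) x) = comul (R := L) (x : L[G]) := squareMap_comulHom ρ x

theorem algebraMap_counit (x : fixed ρ) :
    algebraMap K L (counit (R := K) x) = counit (R := L) (x : L[G]) := algebraMap_counitHom ρ x

theorem antipode_mem (x : fixed ρ) : HopfAlgebra.antipode L (x : L[G]) ∈ fixed ρ := by
  induction x using fixed_induction with
  | hadd x y hx hy => simpa using add_mem hx hy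
  | h0 => simp
  | hs g l =>
    have : HopfAlgebra.antipode L (orbitSum ρ (MonoidAlgebra.single g l) : L[G]) =
      orbitSum ρ (MonoidAlgebra.single g⁻¹ l) := by simp [coe_orbitSum]
    rw [this]; exact (orbitSum ρ _).2

/-- The antipode on the fixed points. -/
noncomputable def antipodeHom : fixed ρ →ₗ[K] fixed ρ :=
  LinearMap.codRestrict (Subalgebra.toSubmodule (fixed ρ))
    (((HopfAlgebra.antipode L (A := L[G])).restrictScalars K).comp (fixed ρ).val.toLinearMap)
    (antipode_mem ρ)

@[simp] theorem coe_antipodeHom (x : fixed ρ) :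
    (antipodeHom ρ x : L[G]) = HopfAlgebra.antipode L (x : L[G]) := rfl

noncomputable instance : HopfAlgebra K (fixed ρ) where
  antipode := antipodeHom ρ
  mul_antipode_rTensor_comul := by
    ext1 x
    ext1
    have h1 (t : fixed ρ ⊗[K] fixed ρ) :
        ((LinearMap.mul' K (fixed ρ) (LinearMap.rTensor _ (antipodeHom ρ) t) : fixed ρ) : L[G]) =
        LinearMap.mul' L L[G] ((HopfAlgebra.antipode L (A := L[G])).rTensor _ (squareMap ρ t)) := by
      induction t with
      | zero => simp
      | add a b ha hb => simp only [map_add, ha, hb, Subalgebra.coe_add]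
      | tmul a b => simp
    refine (h1 _).trans ?_
    rw [squareMap_comul, HopfAlgebra.mul_antipode_rTensor_comul_apply, ← algebraMap_counit]
    simp [← IsScalarTower.algebraMap_apply]
  mul_antipode_lTensor_comul := by
    ext1 x
    ext1
    have h1 (t : fixed ρ ⊗[K] fixed ρ) :
        ((LinearMap.mul' K (fixed ρ) (LinearMap.lTensor _ (antipodeHom ρ) t) : fixed ρ) : L[G]) =
        LinearMap.mul' L L[G] ((HopfAlgebra.antipode L (A := L[G])).lTensor _ (squareMap ρ t)) := by
      induction t with
      | zero => simp
      | add a b ha hb => simp only [map_add, ha, hb, Subalgebra.coe_add]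
      | tmul a b => simp
    refine (h1 _).trans ?_
    rw [squareMap_comul, HopfAlgebra.mul_antipode_lTensor_comul_apply, ← algebraMap_counit]
    simp [← IsScalarTower.algebraMap_apply]

instance : IsCocomm K (fixed ρ) where
  comm_comp_comul := by
    ext1 x
    apply squareMap_injective ρ
    have h1 (t : fixed ρ ⊗[K] fixed ρ) : squareMap ρ (TensorProduct.comm K _ _ t) =
        TensorProduct.comm L _ _ (squareMap ρ t) := by
      induction t with
      | zero => simp
      | add a b ha hb => simp only [map_add, ha, hb]
      | tmul a b => simp
    refine (h1 _).trans ?_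
    rw [squareMap_comul, comm_comul]

theorem baseChangeHom_bijective : Function.Bijective (baseChangeHom ρ) := by
  let b := Module.Basis.ofVectorSpace K (fixed ρ)
  let e := (b.baseChange L).equiv (basisOfFixed ρ b) (Equiv.refl _)
  have h : (baseChangeHom ρ).toLinearMap = e.toLinearMap :=
    (b.baseChange L).ext fun i => by
      have : e (b.baseChange L i) = basisOfFixed ρ b i := Module.Basis.equiv_apply ..
      rw [LinearEquiv.coe_coe, this]
      simp
  have h2 : ⇑(baseChangeHom ρ) = ⇑e := funext fun x => LinearMap.congr_fun h x
  rw [h2]; exact e.bijective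

/-- The group algebra is the base change of the fixed points, as a bialgebra. -/
noncomputable def baseChangeEquiv : L ⊗[K] fixed ρ ≃ₐc[L] L[G] :=
  .ofAlgEquiv (AlgEquiv.ofBijective (baseChangeHom ρ) (baseChangeHom_bijective ρ))
    (by
      ext x
      simp [← algebraMap_counit])
    (by
      ext x
      have h1 (t : fixed ρ ⊗[K] fixed ρ) :
          TensorProduct.map (baseChangeHom ρ).toLinearMap (baseChangeHom ρ).toLinearMap
            (tensorMapOver L (TensorProduct.mk K L _ 1) (TensorProduct.mk K L _ 1) t) =
          squareMap ρ t := by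
        induction t with
        | zero => simp
        | add a b ha hb => rw [map_add, map_add, ha, hb, map_add]
        | tmul a b => simp
      have h2 := h1 (comul x)
      rw [squareMap_comul, ← comul_one_tmul] at h2
      refine h2.trans (congrArg (comul (R := L)) ?_)
      simp)

end GaloisDescent

/-! ### From crossed homomorphisms to Hopf-Galois structures -/

namespace GaloisDescent

open scoped MonoidAlgebra
open Coalgebra

variable {K : Type u} {L : Type v} [Field K] [Field L] [Algebra K L]
  {G : Type v}

/-- The `L`-linear extension of a bijection from the group elements to Galois automorphisms. -/
noncomputable def actMap (φ : (L ≃ₐ[K] L) ≃ G) : L[G] →ₗ[L] Module.End K L :=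
  Finsupp.linearCombination L (fun g => (φ.symm g).toLinearMap) ∘ₗ
    (MonoidAlgebra.coeffLinearEquiv L).toLinearMap

@[simp] theorem actMap_single (φ : (L ≃ₐ[K] L) ≃ G) (g : G) (l : L) :
    actMap φ (MonoidAlgebra.single g l) = l • (φ.symm g).toLinearMap := by
  simp [actMap]

theorem actMap_mul_apply (φ : (L ≃ₐ[K] L) ≃ G) (w : L[G]) (x y : L) :
    actMap φ w (x * y) = LinearMap.mul' L L
      (TensorProduct.map ((actMap φ).flip x) ((actMap φ).flip y) (comul (R := L) w)) := by
  induction w using MonoidAlgebra.induction_linear with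
  | zero => simp
  | add a b ha hb => simp [ha, hb]
  | single a l => simp [mul_left_comm]

theorem actMap_apply_algebraMap (φ : (L ≃ₐ[K] L) ≃ G) (w : L[G]) (k : K) :
    actMap φ w (algebraMap K L k) = counit (R := L) w * algebraMap K L k := by
  induction w using MonoidAlgebra.induction_linear with
  | zero => simp
  | add a b ha hb => simp [ha, hb, add_mul]
  | single a l => simp

variable [Group G] {φ : (L ≃ₐ[K] L) ≃ G} (h : IsCocycle φ)

/-- The crossed-homomorphism identity, extended semilinearly to `L[G]`: moving an automorphism past
scalars costs exactly the twist. -/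
theorem comp_actMap (g : G) (y : L[G]) :
    (φ.symm g).toLinearMap * actMap φ y =
      actMap φ (MonoidAlgebra.single g 1 * twist h.action (φ.symm g) y) := by
  induction y using MonoidAlgebra.induction_linear with
  | zero => simp
  | add a b ha hb => simp only [map_add, mul_add, ha, hb]
  | single k m =>
    ext x
    simp [h.symm_mul]

/-- `actMap` is not multiplicative on all of `L[G]`; the twist in `comp_actMap` disappears when the
right factor is fixed. -/
theorem actMap_mul (x y : L[G]) (hy : y ∈ fixed h.action) :
    actMap φ (x * y) = actMap φ x * actMap φ y := by
  induction x using MonoidAlgebra.induction_linear with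
  | zero => simp
  | add a b ha hb => simp only [map_add, add_mul, ha, hb]
  | single g l =>
    have h1 := comp_actMap h g y
    rw [(mem_fixed _).1 hy] at h1
    have h2 : (MonoidAlgebra.single g l : L[G]) = l • MonoidAlgebra.single g 1 := by simp
    rw [h2, smul_mul_assoc, map_smul, ← h1, map_smul, actMap_single, one_smul, smul_mul_assoc]

/-- The action of the descended Hopf algebra on `L`. -/
noncomputable def act : fixed h.action →ₐ[K] Module.End K L :=
  AlgHom.ofLinearMap (((actMap φ).restrictScalars K).comp (fixed h.action).val.toLinearMap)
    (by
      ext x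
      have h1 : φ.symm 1 = 1 := by rw [Equiv.symm_apply_eq, h.map_one]
      simp [MonoidAlgebra.one_def, h1])
    (fun x y => actMap_mul h _ _ y.2)

@[simp] theorem act_apply (x : fixed h.action) : act h x = actMap φ x := rfl

variable [FiniteDimensional K L] [IsGalois K L]

/-- Injectivity of L ⊗ L → ∏_γ L, by an explicit inversion formula: expand the second factor in the
basis b_i and move the trace coefficients to the left. -/
theorem tensor_eq_zero {z : L ⊗[K] L}
    (hz : ∀ γ : L ≃ₐ[K] L, LinearMap.mul' K L (γ.toLinearMap.lTensor L z) = 0) : z = 0 := by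
  classical
  obtain ⟨n, b, m, hbm⟩ := exists_galois_dual K L
  have key : z = ∑ i, ∑ γ : L ≃ₐ[K] L,
      (LinearMap.mul' K L (γ.toLinearMap.lTensor L z) * γ (m i)) ⊗ₜ b i := by
    clear hz
    induction z with
    | zero => simp
    | add a b ha hb =>
      simp only [map_add, add_mul, TensorProduct.add_tmul, Finset.sum_add_distrib]
      rw [← ha, ← hb]
    | tmul x y =>
      have hy : y = ∑ i, Algebra.trace K L (y * m i) • b i := by
        simp only [algebra_compatible_smul L (Algebra.trace K L _), trace_eq_sum_automorphisms,
          Finset.sum_mul, map_mul, smul_eq_mul]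
        rw [Finset.sum_comm]
        have h1 (γ : L ≃ₐ[K] L) : ∑ i, γ y * γ (m i) * b i = γ y * if 1 = γ then 1 else 0 := by
          rw [← galois_dual_pair hbm, Finset.mul_sum]
          exact Finset.sum_congr rfl fun i _ => by rw [AlgEquiv.one_apply]; ring
        simp [h1]
      conv_lhs => rw [hy, TensorProduct.tmul_sum]
      refine Finset.sum_congr rfl fun i _ => ?_
      rw [← TensorProduct.smul_tmul, ← TensorProduct.sum_tmul]
      congr 1
      rw [algebra_compatible_smul L (Algebra.trace K L _), trace_eq_sum_automorphisms,
        Finset.sum_smul]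
      refine Finset.sum_congr rfl fun γ _ => ?_
      simp [mul_left_comm, mul_comm]
  rw [key]
  simp [hz]

theorem finrank_fixed (ρ : (L ≃ₐ[K] L) →* MulAut G) :
    Module.finrank K (fixed ρ) = Nat.card G := by
  rw [Module.finrank_eq_nat_card_basis (Module.Basis.ofVectorSpace K (fixed ρ)),
    ← Module.finrank_eq_nat_card_basis (basisOfFixed ρ (Module.Basis.ofVectorSpace K (fixed ρ))),
    ← Module.finrank_eq_nat_card_basis (Module.Basis.ofRepr (MonoidAlgebra.coeffLinearEquiv L))]

instance (ρ : (L ≃ₐ[K] L) →* MulAut G) [Finite G] : FiniteDimensional K (fixed ρ) := by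
  cases nonempty_fintype G
  let b := Module.Basis.ofVectorSpace K (fixed ρ)
  have := Module.Finite.of_basis (Module.Basis.ofRepr (MonoidAlgebra.coeffLinearEquiv L : L[G] ≃ₗ[L] _))
  have := Module.Finite.finite_basis (basisOfFixed ρ b)
  exact Module.Finite.of_basis b

theorem bijective_of_apply_tmul (θ : L ⊗[K] L →ₗ[K] (fixed h.action →ₗ[K] L))
    (hθ : ∀ x y c, θ (x ⊗ₜ y) c = x * actMap φ (c : L[G]) y) : Function.Bijective θ := by
  have hfin : Finite G := Finite.of_equiv _ φ
  have hinj : Function.Injective θ := by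
    rw [injective_iff_map_eq_zero]
    intro z hz
    -- θ z extends to an `L`-linear form on `L[G]`. If θ z = 0, the form vanishes on a spanning set,
    -- hence on each group element, so every component of z in ∏_γ L is zero.
    let Φ : L ⊗[K] L →ₗ[K] (L[G] →ₗ[L] L) := TensorProduct.lift <| LinearMap.mk₂ K
      (fun x y : L => x • (actMap φ).flip y)
      (fun _ _ _ => by rw [add_smul]) (fun _ _ _ => by rw [smul_assoc])
      (fun _ _ _ => by rw [map_add, smul_add]) (fun _ _ _ => by
        ext; simp [Algebra.smul_def]; ring)
    have hΦ (z : L ⊗[K] L) (c : fixed h.action) : θ z c = Φ z c := by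
      induction z with
      | zero => simp
      | add a b ha hb => simp [ha, hb]
      | tmul x y => simp [hθ, Φ]
    have h0 : Φ z = 0 := by
      refine LinearMap.ext_on (span_fixed h.action) fun c hc => ?_
      rw [← hΦ z ⟨c, hc⟩, hz]; simp
    refine tensor_eq_zero fun γ => ?_
    have h1 (z : L ⊗[K] L) : LinearMap.mul' K L (γ.toLinearMap.lTensor L z) =
        Φ z (MonoidAlgebra.single (φ γ) 1) := by
      induction z with
      | zero => simp
      | add a b ha hb => simp [ha, hb]
      | tmul x y => simp [Φ]
    rw [h1, h0]; rfl
  refine ⟨hinj, (LinearMap.injective_iff_surjective_of_finrank_eq_finrank ?_).1 hinj⟩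
  rw [Module.finrank_tensorProduct, Module.finrank_linearMap, finrank_fixed, ← Nat.card_congr φ,
    IsGalois.card_aut_eq_finrank]

/-- The Hopf-Galois structure attached to a bijective crossed homomorphism. -/
noncomputable def hopfGaloisStructure : HopfGaloisStructure K L where
  carrier := fixed h.action
  act := act h
  act_mul c x y := by
    have h1 (t : fixed h.action ⊗[K] fixed h.action) :
        LinearMap.mul' K L (TensorProduct.map ((act h).toLinearMap.flip x)
          ((act h).toLinearMap.flip y) t) =
        LinearMap.mul' L L (TensorProduct.map ((actMap φ).flip x) ((actMap φ).flip y)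
          (squareMap h.action t)) := by
      induction t with
      | zero => simp
      | add a b ha hb => simp [ha, hb]
      | tmul a b => simp
    rw [h1, squareMap_comul, act_apply, actMap_mul_apply]
  act_algebraMap c k := by
    rw [act_apply, actMap_apply_algebraMap, map_mul, algebraMap_counit]
  bijective_theta := bijective_of_apply_tmul h _ fun x y c => by simp

theorem isOfType_hopfGaloisStructure : (hopfGaloisStructure h).IsOfType G :=
  ⟨baseChangeEquiv h.action⟩

end GaloisDescent

namespace IsCocycle

/-- Bijective crossed homomorphisms are identified when they differ by an automorphism. -/
def setoid (Γ G : Type*) [Group Γ] [Group G] : Setoid {φ : Γ ≃ G // IsCocycle φ} where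
  r φ ψ := ∃ f : MulAut G, ∀ γ, ψ.1 γ = f (φ.1 γ)
  iseqv :=
    { refl := fun φ => ⟨1, fun _ => rfl⟩
      symm := by
        rintro φ ψ ⟨f, hf⟩
        exact ⟨f⁻¹, fun γ => by rw [hf]; simp⟩
      trans := by
        rintro φ ψ χ ⟨f, hf⟩ ⟨k, hk⟩
        exact ⟨k * f, fun γ => by rw [hk, hf]; rfl⟩ }

end IsCocycle

/-! ### From Hopf-Galois structures back to crossed homomorphisms -/

namespace HopfGaloisStructure

open scoped MonoidAlgebra
open Coalgebra

variable {K : Type u} {L : Type v} [Field K] [Field L] [Algebra K L]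
  (S : HopfGaloisStructure K L)

/-- The `L`-linear extension of the action. -/
noncomputable def actBaseChange : L ⊗[K] S.carrier →ₗ[L] Module.End K L :=
  S.act.toLinearMap.liftBaseChange L

@[simp] theorem actBaseChange_tmul (l : L) (h : S.carrier) :
    S.actBaseChange (l ⊗ₜ h) = l • S.act h := by
  simp [actBaseChange]

theorem actBaseChange_mul_tmul (ξ : L ⊗[K] S.carrier) (l : L) (h : S.carrier) :
    S.actBaseChange (ξ * l ⊗ₜ h) = l • (S.actBaseChange ξ * S.act h) := by
  induction ξ with
  | zero => simp
  | add a b ha hb => simp only [map_add, add_mul, smul_add, ha, hb]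
  | tmul a b => simp [mul_smul, mul_comm a l, smul_mul_assoc]

/-- The Galois action on the first factor of the base change. -/
noncomputable def galTwist (γ : L ≃ₐ[K] L) : L ⊗[K] S.carrier →ₐ[K] L ⊗[K] S.carrier :=
  Algebra.TensorProduct.map (γ : L →ₐ[K] L) (AlgHom.id K S.carrier)

@[simp] theorem galTwist_tmul (γ : L ≃ₐ[K] L) (l : L) (h : S.carrier) :
    S.galTwist γ (l ⊗ₜ h) = γ l ⊗ₜ h := by
  simp [galTwist]

theorem comp_actBaseChange {γ : L ≃ₐ[K] L} {ε : L ⊗[K] S.carrier}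
    (hε : S.actBaseChange ε = γ.toLinearMap) (ξ : L ⊗[K] S.carrier) :
    γ.toLinearMap * S.actBaseChange ξ = S.actBaseChange (ε * S.galTwist γ ξ) := by
  induction ξ with
  | zero => simp
  | add a b ha hb => simp only [map_add, mul_add, ha, hb]
  | tmul a b =>
    rw [galTwist_tmul, actBaseChange_mul_tmul, hε]
    ext x
    simp

theorem exists_theta (f : S.carrier →ₗ[K] L) : ∃ θ : L ⊗[K] L →ₗ[K] (S.carrier →ₗ[K] L),
    (∀ x y h, θ (x ⊗ₜ y) h = x * S.act h y) ∧ ∃ z, θ z = f :=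
  ⟨_, fun x y h => by simp, S.bijective_theta.2 f⟩

/-- Surjectivity of θ writes any `K`-linear H → L as a sum of forms h ↦ x (h · y). If ξ acts as
zero, all of these kill ξ, in particular the coordinate forms of a basis. -/
theorem actBaseChange_injective : Function.Injective S.actBaseChange := by
  rw [injective_iff_map_eq_zero]
  intro ξ hξ
  have h1 (f : S.carrier →ₗ[K] L) : f.liftBaseChange L ξ = 0 := by
    obtain ⟨θ, hθ, z, rfl⟩ := S.exists_theta f
    induction z with
    | zero => simp
    | add a b ha hb => 
      have : (θ (a + b)).liftBaseChange L = (θ a).liftBaseChange L + (θ b).liftBaseChange L := by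
        ext; simp
      rw [this, LinearMap.add_apply, ha, hb, add_zero]
    | tmul x y =>
      have : (θ (x ⊗ₜ y)).liftBaseChange L = x • S.actBaseChange.flip y := by
        ext; simp [hθ]
      rw [this]; simp [hξ]
  let b := Module.Basis.ofVectorSpace K S.carrier
  refine (b.baseChange L).ext_elem fun i => ?_
  have h2 : (b.baseChange L).coord i =
      ((Algebra.linearMap K L).comp (b.coord i)).liftBaseChange L := by
    refine (b.baseChange L).ext fun k => ?_
    classical
    simp [Finsupp.single_apply, apply_ite]
  have h3 := h1 ((Algebra.linearMap K L).comp (b.coord i))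
  rw [← h2] at h3
  simpa using h3

theorem actBaseChange_mul_apply (ξ : L ⊗[K] S.carrier) (x y : L) :
    S.actBaseChange ξ (x * y) = LinearMap.mul' L L (TensorProduct.map (S.actBaseChange.flip x)
      (S.actBaseChange.flip y) (comul (R := L) ξ)) := by
  induction ξ with
  | zero => simp
  | add a b ha hb => simp only [map_add, LinearMap.add_apply, ha, hb]
  | tmul l h =>
    have h1 (t : S.carrier ⊗[K] S.carrier) :
        LinearMap.mul' L L (TensorProduct.map (S.actBaseChange.flip x)
          (S.actBaseChange.flip y)
          (tensorMapOver L (TensorProduct.mk K L S.carrier 1) (TensorProduct.mk K L S.carrier 1) t)) =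
        LinearMap.mul' K L (TensorProduct.map (S.act.toLinearMap.flip x)
          (S.act.toLinearMap.flip y) t) := by
      induction t with
      | zero => simp
      | add a b ha hb => simp only [map_add, ha, hb]
      | tmul a b => simp
    have h2 : l ⊗ₜ[K] h = l • ((1 : L) ⊗ₜ[K] h) := by simp [TensorProduct.smul_tmul']
    rw [h2, map_smul, map_smul, comul_one_tmul, map_smul, map_smul, h1, ← S.act_mul]
    simp

theorem actBaseChange_apply_one (ξ : L ⊗[K] S.carrier) :
    S.actBaseChange ξ 1 = counit (R := L) ξ := by
  induction ξ with
  | zero => simp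
  | add a b ha hb => simp only [map_add, LinearMap.add_apply, ha, hb]
  | tmul l h =>
    have := S.act_algebraMap h 1
    rw [map_one] at this
    simp [this, Algebra.smul_def, mul_comm]

/-- The type of Hopf-Galois structures depends only on the isomorphism class of the group. -/
theorem isOfType_congr {G : Type*} {G' : Type*} [Group G] [Group G'] (e : G ≃* G') :
    S.IsOfType G ↔ S.IsOfType G' :=
  ⟨fun ⟨Ψ⟩ => ⟨Ψ.trans (MonoidAlgebra.domCongrBialgEquiv L L e)⟩,
    fun ⟨Ψ⟩ => ⟨Ψ.trans (MonoidAlgebra.domCongrBialgEquiv L L e.symm)⟩⟩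

/-- Isomorphic groups give the same Hopf-Galois structures. -/
def ofTypeCongr {G : Type*} {G' : Type*} [Group G] [Group G'] (e : G ≃* G') :
    OfType K L G ≃ OfType K L G' :=
  Quotient.congr (Equiv.subtypeEquivRight fun S => S.isOfType_congr e) fun _ _ => Iff.rfl

/-- The base-changed isomorphism carries group-likes to group-likes, hence induces a homomorphism G
→ G. Since it respects the action on `L`, this map is ψ ∘ φ⁻¹. -/
theorem Equivalent.exists_mulAut {S T : HopfGaloisStructure K L} (hST : S.Equivalent T)
    {G : Type*} [Group G] {φ ψ : (L ≃ₐ[K] L) ≃ G} (Ψ : L ⊗[K] S.carrier ≃ₐc[L] L[G])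
    (hΨ : ∀ g, S.actBaseChange (Ψ.symm (MonoidAlgebra.single g 1)) = (φ.symm g).toLinearMap)
    (Ω : L ⊗[K] T.carrier ≃ₐc[L] L[G])
    (hΩ : ∀ g, T.actBaseChange (Ω.symm (MonoidAlgebra.single g 1)) = (ψ.symm g).toLinearMap) :
    ∃ f : MulAut G, ∀ γ, ψ γ = f (φ γ) := by
  obtain ⟨e, he⟩ := hST
  let F : L ⊗[K] S.carrier →ₐc[L] L ⊗[K] T.carrier :=
    Bialgebra.TensorProduct.map (BialgHom.id L L) e.toBialgHom
  have hF (ξ : L ⊗[K] S.carrier) : T.actBaseChange (F ξ) = S.actBaseChange ξ := by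
    induction ξ with
    | zero => simp
    | add a b ha hb => rw [map_add, map_add, map_add, ha, hb]
    | tmul l c =>
      ext x
      simp [F, he]
  let E : L[G] →ₐc[L] L[G] := Ω.toBialgHom.comp (F.comp Ψ.symm.toBialgHom)
  have hE (w : L[G]) : E w = Ω (F (Ψ.symm w)) := rfl
  have hex (g : G) : ∃ k : G, MonoidAlgebra.single k 1 = E (MonoidAlgebra.single g 1) :=
    MonoidAlgebra.isGroupLikeElem_iff_mem_range_single_one.1
      ((MonoidAlgebra.isGroupLikeElem_single_one g).map E)
  choose f hf using hex
  have hfφ (g : G) : f g = ψ (φ.symm g) := by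
    have h1 : Ω.symm (MonoidAlgebra.single (f g) 1) = F (Ψ.symm (MonoidAlgebra.single g 1)) := by
      rw [hf, hE, BialgEquiv.symm_apply_apply]
    have h2 := congrArg T.actBaseChange h1
    rw [hF, hΨ, hΩ] at h2
    rw [← Equiv.symm_apply_eq]
    exact AlgEquiv.ext fun x => LinearMap.congr_fun h2 x
  have hmul (g k : G) : f (g * k) = f g * f k := by
    have h1 : (MonoidAlgebra.single (f (g * k)) 1 : L[G]) = MonoidAlgebra.single (f g * f k) 1 := by
      rw [hf, ← one_mul (1 : L), ← MonoidAlgebra.single_mul_single,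
        ← MonoidAlgebra.single_mul_single, hf, hf, map_mul]
    exact Finsupp.single_left_injective one_ne_zero (congrArg MonoidAlgebra.coeff h1)
  refine ⟨MulEquiv.mk' (φ.symm.trans ψ) fun g k => ?_, fun γ => ?_⟩
  · simpa [← hfφ] using hmul g k
  · change _ = ψ (φ.symm (φ γ))
    simp

variable [FiniteDimensional K L] [IsGalois K L] {G : Type v} [Group G]

/-- A group-like ξ satisfies ξ(xy) = ξ(x)ξ(y) and ξ(1) = 1, so it acts as a field automorphism.
Faithfulness of the action and equality of orders make g ↦ automorphism a bijection. -/
theorem exists_cocycle (hG : Nat.card G = Module.finrank K L)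
    (Ψ : L ⊗[K] S.carrier ≃ₐc[L] L[G]) : ∃ φ : (L ≃ₐ[K] L) ≃ G, IsCocycle φ ∧
      ∀ g, S.actBaseChange (Ψ.symm (MonoidAlgebra.single g 1)) = (φ.symm g).toLinearMap := by
  have hfin : Finite G := Nat.finite_of_card_ne_zero (by rw [hG]; exact Module.finrank_pos.ne')
  let e : G → L ⊗[K] S.carrier := fun g => Ψ.symm (MonoidAlgebra.single g 1)
  have he (g k : G) : e (g * k) = e g * e k := by
    simp only [e]; rw [← map_mul]; simp
  have hinj : Function.Injective e := fun g k h => by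
    have := Ψ.symm.injective h
    exact Finsupp.single_left_injective one_ne_zero (congrArg MonoidAlgebra.coeff this)
  have hgl (g : G) : IsGroupLikeElem L (e g) :=
    (MonoidAlgebra.isGroupLikeElem_single_one g).map Ψ.symm
  have hex (g : G) : ∃ γ : L ≃ₐ[K] L, S.actBaseChange (e g) = γ.toLinearMap := by
    let T : L →ₐ[K] L := AlgHom.ofLinearMap (S.actBaseChange (e g))
      (by rw [actBaseChange_apply_one, (hgl g).counit_eq_one])
      (fun x y => by rw [actBaseChange_mul_apply, (hgl g).comul_eq_tmul_self]; simp)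
    exact ⟨AlgEquiv.ofBijective T (Algebra.IsAlgebraic.algHom_bijective T), by ext; rfl⟩
  choose t ht using hex
  have htinj : Function.Injective t := fun g k h =>
    hinj (S.actBaseChange_injective (by rw [ht, ht, h]))
  have htbij : Function.Bijective t := by
    refine (Nat.bijective_iff_injective_and_card t).2 ⟨htinj, ?_⟩
    rw [hG, IsGalois.card_aut_eq_finrank]
  let φ : (L ≃ₐ[K] L) ≃ G := (Equiv.ofBijective t htbij).symm
  have hφt (g) : φ (t g) = g := (Equiv.ofBijective t htbij).symm_apply_apply g
  have htφ (γ) : t (φ γ) = γ := (Equiv.ofBijective t htbij).apply_symm_apply γ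
  refine ⟨φ, fun γ => ?_, ht⟩
  -- The only map compatible with the crossed-homomorphism identity. By `key` it is the Galois
  -- action on group-likes, which is multiplicative.
  let f : G ≃ G := φ.symm.trans ((Equiv.mulLeft γ).trans (φ.trans (Equiv.mulLeft (φ γ)⁻¹)))
  have hf (k : G) : f k = (φ γ)⁻¹ * φ (γ * t k) := rfl
  have key (k : G) : S.galTwist γ (e k) = e (f k) := by
    have h1 : e (φ γ) * S.galTwist γ (e k) = e (φ (γ * t k)) := by
      apply S.actBaseChange_injective
      rw [← S.comp_actBaseChange (by rw [ht, htφ]), ht, ht, htφ]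
      rfl
    have h2 : e (φ γ)⁻¹ * e (φ γ) = 1 := by
      rw [← he, inv_mul_cancel]; simp [e, ← MonoidAlgebra.one_def]
    rw [hf, he, ← h1, ← mul_assoc, h2, one_mul]
  refine ⟨MulEquiv.mk' f fun k k' => hinj ?_, fun δ => ?_⟩
  · rw [← key, he, map_mul, key, key, he]
  · change _ = φ γ * f (φ δ)
    rw [hf, htφ, mul_inv_cancel_left]

open GaloisDescent

/-- Under Ψ the Galois action on scalars becomes the twist, so 1 ⊗ H lands in the fixed points. Both
sides have dimension |G|, so injectivity suffices. -/
theorem equivalent_hopfGaloisStructure (Ψ : L ⊗[K] S.carrier ≃ₐc[L] L[G])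
    {φ : (L ≃ₐ[K] L) ≃ G} (hφ : IsCocycle φ)
    (h : ∀ g, S.actBaseChange (Ψ.symm (MonoidAlgebra.single g 1)) = (φ.symm g).toLinearMap) :
    S.Equivalent (hopfGaloisStructure hφ) := by
  have hact (w : L[G]) : S.actBaseChange (Ψ.symm w) = actMap φ w := by
    induction w using MonoidAlgebra.induction_linear with
    | zero => simp
    | add a b ha hb => simp only [map_add, ha, hb]
    | single g l =>
      have h1 : (MonoidAlgebra.single g l : L[G]) = l • MonoidAlgebra.single g 1 := by simp
      rw [h1, map_smul, map_smul, h]; simp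
  have htw (γ : L ≃ₐ[K] L) (w : L[G]) : S.galTwist γ (Ψ.symm w) = Ψ.symm (twist hφ.action γ w) := by
    have h0 : Ψ.symm (MonoidAlgebra.single (φ γ)⁻¹ 1) * Ψ.symm (MonoidAlgebra.single (φ γ) 1) = 1 := by
      rw [← map_mul]; simp [← MonoidAlgebra.one_def]
    have h1 : Ψ.symm (MonoidAlgebra.single (φ γ) 1) * S.galTwist γ (Ψ.symm w) =
        Ψ.symm (MonoidAlgebra.single (φ γ) 1) * Ψ.symm (twist hφ.action γ w) := by
      apply S.actBaseChange_injective
      rw [← S.comp_actBaseChange (by rw [h]; simp), ← map_mul, hact, hact]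
      simpa using comp_actMap hφ (φ γ) w
    rw [← one_mul (S.galTwist γ _), ← h0, mul_assoc, h1, ← mul_assoc, h0, one_mul]
  have hmem (c : S.carrier) : Ψ (1 ⊗ₜ c) ∈ fixed hφ.action := by
    rw [mem_fixed]
    intro γ
    apply (EquivLike.injective Ψ.symm)
    rw [← htw, Ψ.symm_apply_apply]
    simp
  let e : S.carrier →ₐ[K] fixed hφ.action :=
    (((Ψ : L ⊗[K] S.carrier →ₐ[L] L[G]).restrictScalars K).comp
      Algebra.TensorProduct.includeRight).codRestrict (fixed hφ.action) hmem
  have he (c : S.carrier) : (e c : L[G]) = Ψ (1 ⊗ₜ c) := rfl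
  have hcounit (c : S.carrier) : counit (R := K) (e c) = counit (R := K) c := by
    apply (algebraMap K L).injective
    rw [algebraMap_counit, he, CoalgHomClass.counit_comp_apply]
    simp [Algebra.algebraMap_eq_smul_one]
  have hcomul (c : S.carrier) :
      TensorProduct.map e.toLinearMap e.toLinearMap (comul (R := K) c) = comul (R := K) (e c) := by
    apply squareMap_injective
    rw [squareMap_comul, he, ← CoalgHomClass.map_comp_comul_apply, comul_one_tmul]
    generalize comul (R := K) c = t
    induction t with
    | zero => simp
    | add a b ha hb => simp only [map_add, ha, hb]
    | tmul a b => simp [he]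
  have hbij : Function.Bijective e := by
    have hfin : Finite G := Finite.of_equiv _ φ
    have hinj : Function.Injective e := fun c d hcd => by
      have h1 : Ψ (1 ⊗ₜ c) = Ψ (1 ⊗ₜ d) := congrArg Subtype.val hcd
      exact Algebra.TensorProduct.includeRight_injective (algebraMap K L).injective (Ψ.injective h1)
    have : FiniteDimensional K S.carrier := Module.Finite.of_injective e.toLinearMap hinj
    refine ⟨hinj, (LinearMap.injective_iff_surjective_of_finrank_eq_finrank (f := e.toLinearMap) ?_).1 hinj⟩
    have h1 := LinearEquiv.finrank_eq (R := L) (M := L ⊗[K] S.carrier) (N := L[G]) (Ψ : _ ≃ₐ[L] _).toLinearEquiv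
    rw [Module.finrank_baseChange] at h1
    rw [h1, finrank_fixed, Module.finrank_eq_nat_card_basis (Module.Basis.ofRepr (MonoidAlgebra.coeffLinearEquiv L : L[G] ≃ₗ[L] _))]
  refine ⟨.ofAlgEquiv (AlgEquiv.ofBijective e hbij) ?_ ?_, fun c x => ?_⟩
  · ext c; exact hcounit c
  · ext c; exact hcomul c
  · change actMap φ (e c : L[G]) x = _
    rw [he, ← hact]
    simp [Ψ.symm_apply_apply]

theorem exists_equiv_actBaseChange {φ : (L ≃ₐ[K] L) ≃ G} (hφ : IsCocycle φ) :
    ∃ Ψ : L ⊗[K] (hopfGaloisStructure hφ).carrier ≃ₐc[L] L[G],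
      ∀ g, (hopfGaloisStructure hφ).actBaseChange (Ψ.symm (MonoidAlgebra.single g 1)) =
        (φ.symm g).toLinearMap := by
  refine ⟨baseChangeEquiv hφ.action, fun g => ?_⟩
  have h1 : (GaloisDescent.act hφ).toLinearMap.liftBaseChange L =
      (actMap φ).comp (baseChangeHom hφ.action).toLinearMap := by
    ext; simp
  have h2 := BialgEquiv.apply_symm_apply (baseChangeEquiv hφ.action) (MonoidAlgebra.single g 1)
  refine (LinearMap.congr_fun h1 _).trans ((congrArg (actMap φ) h2).trans ?_)
  rw [actMap_single, one_smul]

theorem hopfGaloisStructure_equivalent_iff {φ ψ : (L ≃ₐ[K] L) ≃ G} (hφ : IsCocycle φ)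
    (hψ : IsCocycle ψ) : (hopfGaloisStructure hφ).Equivalent (hopfGaloisStructure hψ) ↔
      ∃ f : MulAut G, ∀ γ, ψ γ = f (φ γ) := by
  constructor
  · intro h
    obtain ⟨Ψ, hΨ⟩ := exists_equiv_actBaseChange hφ
    obtain ⟨Ω, hΩ⟩ := exists_equiv_actBaseChange hψ
    exact h.exists_mulAut Ψ hΨ Ω hΩ
  · rintro ⟨f, hf⟩
    obtain ⟨Ψ, hΨ⟩ := exists_equiv_actBaseChange hφ
    refine equivalent_hopfGaloisStructure _ (Ψ.trans (MonoidAlgebra.domCongrBialgEquiv L L f)) hψ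
      fun g => ?_
    have h1 : (Ψ.trans (MonoidAlgebra.domCongrBialgEquiv L L f)).symm
        (MonoidAlgebra.single g 1) = Ψ.symm (MonoidAlgebra.single (f.symm g) 1) := by
      apply EquivLike.injective (Ψ.trans (MonoidAlgebra.domCongrBialgEquiv L L f))
      rw [BialgEquiv.apply_symm_apply]
      change _ = MonoidAlgebra.domCongr L L f (Ψ (Ψ.symm _))
      rw [BialgEquiv.apply_symm_apply]
      simp
    rw [h1, hΨ]
    congr 1
    rw [Equiv.symm_apply_eq, ← f.injective.eq_iff, ← hf]
    simp

/-- Hopf-Galois structures of type `G` correspond to bijective crossed homomorphisms from the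
Galois group to `G`, up to automorphisms of `G`. -/
noncomputable def ofTypeEquiv (hG : Nat.card G = Module.finrank K L) :
    Quotient (IsCocycle.setoid (L ≃ₐ[K] L) G) ≃ OfType K L G :=
  Equiv.ofBijective
    (Quotient.map (fun φ => ⟨hopfGaloisStructure φ.2, isOfType_hopfGaloisStructure φ.2⟩)
      fun φ ψ h => (hopfGaloisStructure_equivalent_iff φ.2 ψ.2).2 h) <| by
    refine ⟨fun a b => ?_, fun a => ?_⟩
    · induction a using Quotient.inductionOn with | _ φ
      induction b using Quotient.inductionOn with | _ ψ
      intro h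
      exact Quotient.sound ((hopfGaloisStructure_equivalent_iff φ.2 ψ.2).1 (Quotient.exact h))
    · induction a using Quotient.inductionOn with | _ S
      obtain ⟨S, ⟨Ψ⟩⟩ := S
      obtain ⟨φ, hφ, h⟩ := S.exists_cocycle hG Ψ
      exact ⟨Quotient.mk _ ⟨φ, hφ⟩, Quotient.sound
        ((setoid K L).symm (S.equivalent_hopfGaloisStructure Ψ hφ h))⟩

end HopfGaloisStructure

/-! ### Affine orbits modulo a squarefree number -/

namespace ZMod

theorem eq_zero_of_forall_prime {N : ℕ} (hN : Squarefree N) {x : ZMod N}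
    (h : ∀ p, p.Prime → ∀ hp : p ∣ N, castHom hp (ZMod p) x = 0) : x = 0 := by
  have : NeZero N := ⟨hN.ne_zero⟩
  have hx := natCast_zmod_val x
  rw [← hx] at h ⊢
  rw [natCast_eq_zero_iff]
  generalize x.val = k at h
  rw [← Nat.prod_primeFactors_of_squarefree hN]
  refine Finset.prod_primes_dvd _ (fun p hp => (Nat.prime_of_mem_primeFactors hp).prime)
    fun p hp => ?_
  have := h p (Nat.prime_of_mem_primeFactors hp) (Nat.dvd_of_mem_primeFactors hp)
  rwa [map_natCast, natCast_eq_zero_iff] at this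

theorem isUnit_of_forall_prime {N : ℕ} [NeZero N] {x : ZMod N}
    (h : ∀ p, p.Prime → ∀ hp : p ∣ N, castHom hp (ZMod p) x ≠ 0) : IsUnit x := by
  have hx := natCast_zmod_val x
  rw [← hx] at h ⊢
  rw [isUnit_iff_coprime]
  refine Nat.coprime_of_dvd fun p hp h1 h2 => h p hp h2 ?_
  rwa [map_natCast, natCast_eq_zero_iff]

/-- An affine permutation of `ZMod N`, `N` squarefree, with a single orbit is a translation. -/
theorem eq_one_of_affine_orbit {N : ℕ} (hN : Squarefree N) {k a : ZMod N} (hk : IsUnit k)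
    {x : ℕ → ZMod N} (h0 : x 0 = 0) (hx : ∀ i, x (i + 1) = a + k * x i)
    (hs : Function.Surjective x) : k = 1 := by
  rw [← sub_eq_zero]
  refine eq_zero_of_forall_prime hN fun p hp hpN => ?_
  have : Fact p.Prime := ⟨hp⟩
  set π := castHom hpN (ZMod p)
  rw [map_sub, map_one, sub_eq_zero]
  by_contra hne
  have hk0 : π k ≠ 0 := (hk.map π).ne_zero
  have hs' : Function.Surjective (π ∘ x) := (ringHom_surjective π).comp hs
  have h1k : 1 - π k ≠ 0 := sub_ne_zero.2 (Ne.symm hne)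
  have hform (i : ℕ) : π (x i) * (1 - π k) = π a * (1 - π k ^ i) := by
    induction i with
    | zero => simp [h0]
    | succ i ih =>
      rw [hx, map_add, map_mul, add_mul, mul_assoc, ih]; ring
  -- This is the fixed point of the affine map mod p. The orbit of 0 reaches it only if a = 0 mod p,
  -- and then the orbit is constantly 0 and misses 1.
  obtain ⟨i, hi⟩ := hs' (π a / (1 - π k))
  have h2 := hform i
  simp only [Function.comp_apply] at hi
  rw [hi, div_mul_cancel₀ _ h1k] at h2
  have h3 : π a * π k ^ i = 0 := by linear_combination h2
  have ha : π a = 0 := (mul_eq_zero.1 h3).resolve_right (pow_ne_zero _ hk0)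
  obtain ⟨j, hj⟩ := hs' 1
  have h4 := hform j
  simp only [Function.comp_apply] at hj
  rw [hj, ha, zero_mul, one_mul] at h4
  exact h1k h4

end ZMod

/-! ### Iterated geometric sums and the admissible values of u -/

/-- The iterated geometric sum `∑_{j < i} (1 + u + ⋯ + u ^ (j - 1)) κ ^ j`. -/
def iteratedGeomSum {R : Type*} [CommRing R] (κ u : R) (i : ℕ) : R :=
  ∑ j ∈ Finset.range i, κ ^ j * ∑ l ∈ Finset.range j, u ^ l

section

variable {R : Type*} [CommRing R] {κ u : R}

theorem sub_one_mul_iteratedGeomSum (κ u : R) (i : ℕ) : (u - 1) * iteratedGeomSum κ u i =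
    ∑ j ∈ Finset.range i, (u * κ) ^ j - ∑ j ∈ Finset.range i, κ ^ j := by
  rw [iteratedGeomSum, Finset.mul_sum, ← Finset.sum_sub_distrib]
  refine Finset.sum_congr rfl fun j _ => ?_
  linear_combination κ ^ j * mul_geom_sum u j

theorem kappa_sub_one_mul_iteratedGeomSum (κ u : R) (i : ℕ) : (κ - 1) * iteratedGeomSum κ u i =
    κ ^ i * ∑ j ∈ Finset.range i, u ^ j - κ * ∑ j ∈ Finset.range i, (u * κ) ^ j := by
  induction i with
  | zero => simp [iteratedGeomSum]
  | succ i ih =>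
    have h : iteratedGeomSum κ u (i + 1) = iteratedGeomSum κ u i +
      κ ^ i * ∑ l ∈ Finset.range i, u ^ l := Finset.sum_range_succ _ _
    rw [h, Finset.sum_range_succ, Finset.sum_range_succ, mul_add, ih]
    ring

theorem geom_sum_eq_zero {m : ℕ} (hκ : IsUnit (κ - 1)) (hm : κ ^ m = 1) :
    ∑ j ∈ Finset.range m, κ ^ j = 0 := by
  have := mul_geom_sum κ m
  rw [hm, sub_self] at this
  exact hκ.mul_right_eq_zero.1 this

/-- The product (uκ - 1)(u - 1)S_m telescopes to (uκ)^m - 1 = 0, and S_m can be cancelled. -/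
theorem mul_eq_zero_of_isUnit_iteratedGeomSum {m : ℕ} (hκ : IsUnit (κ - 1)) (hm : κ ^ m = 1)
    (hu : u ^ m = 1) (hS : IsUnit (iteratedGeomSum κ u m)) : (u - 1) * (u * κ - 1) = 0 := by
  have h1 := sub_one_mul_iteratedGeomSum κ u m
  rw [geom_sum_eq_zero hκ hm, sub_zero] at h1
  have h2 := mul_geom_sum (u * κ) m
  rw [mul_pow, hm, hu, ← h1] at h2
  refine hS.mul_left_eq_zero.1 ?_
  linear_combination h2

theorem map_iteratedGeomSum {R' : Type*} [CommRing R'] (f : R →+* R') (κ u : R) (i : ℕ) :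
    f (iteratedGeomSum κ u i) = iteratedGeomSum (f κ) (f u) i := by
  simp [iteratedGeomSum]

end

/-- Modulo each prime p of g, either u = 1 and (κ - 1)S_m = m, or uκ = 1 and (κ - 1)S_m = -κm. Both
are nonzero because p does not divide m. -/
theorem ZMod.isUnit_iteratedGeomSum {g m : ℕ} [NeZero g] (hg : Squarefree g) (hgm : g.Coprime m)
    {κ u : ZMod g} (hκ : IsUnit (κ - 1)) (hm : κ ^ m = 1) (h : (u - 1) * (u * κ - 1) = 0) :
    IsUnit (iteratedGeomSum κ u m) ∧ u ^ m = 1 := by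
  have key : ∀ p, p.Prime → ∀ hp : p ∣ g, castHom hp (ZMod p) (iteratedGeomSum κ u m) ≠ 0 ∧
      castHom hp (ZMod p) (u ^ m) = 1 := by
    intro p hp hpg
    have : Fact p.Prime := ⟨hp⟩
    set π := castHom hpg (ZMod p)
    have hκ' : IsUnit (π κ - 1) := by simpa using hκ.map π
    have hm' : π κ ^ m = 1 := by simpa using congrArg π hm
    have h' : (π u - 1) * (π u * π κ - 1) = 0 := by simpa using congrArg π h
    have hm0 : (m : ZMod p) ≠ 0 := by
      rw [Ne, natCast_eq_zero_iff]
      intro hpm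
      exact hp.one_lt.ne' (Nat.dvd_one.1 (hgm ▸ Nat.dvd_gcd hpg hpm))
    have hκ0 : π κ ≠ 0 := by
      intro h0; rw [h0] at hm'
      rcases Nat.eq_zero_or_pos m with rfl | hpos
      · simp at hm0
      · rw [zero_pow hpos.ne'] at hm'; exact zero_ne_one hm'
    have hK := kappa_sub_one_mul_iteratedGeomSum (π κ) (π u) m
    rw [map_iteratedGeomSum, map_pow]
    rcases mul_eq_zero.1 h' with h1 | h1
    · have hu : π u = 1 := sub_eq_zero.1 h1
      rw [hu]
      refine ⟨fun h0 => ?_, one_pow m⟩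
      rw [hu, h0, hm'] at hK
      simp only [one_mul, one_pow, geom_sum_eq_zero hκ' hm'] at hK
      simp at hK
      exact hm0 hK.symm
    · have hu : π u * π κ = 1 := sub_eq_zero.1 h1
      have hum : π u ^ m = 1 := by
        have := congrArg (· ^ m) hu
        simpa [mul_pow, hm'] using this
      refine ⟨fun h0 => ?_, hum⟩
      have hu1 : IsUnit (π u - 1) := by
        rw [isUnit_iff_ne_zero]
        intro h2
        rw [sub_eq_zero.1 h2, one_mul] at hu
        rw [hu, sub_self] at hκ'
        exact not_isUnit_zero hκ'
      rw [h0, hu, geom_sum_eq_zero hu1 hum] at hK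
      simp at hK
      rcases hK with hK | hK
      · exact hκ0 hK
      · exact hm0 hK
  refine ⟨isUnit_of_forall_prime fun p hp hpg => (key p hp hpg).1, ?_⟩
  rw [← sub_eq_zero]
  refine eq_zero_of_forall_prime hg fun p hp hpg => ?_
  rw [map_sub, (key p hp hpg).2, map_one, sub_self]

theorem ZMod.card_idempotents {g : ℕ} (hg : Squarefree g) :
    Nat.card {e : ZMod g // e * e = e} = 2 ^ ArithmeticFunction.cardDistinctFactors g := by
  classical
  have hpi : (Pairwise fun p q : g.primeFactors => Nat.Coprime p q) := fun p q hpq =>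
    (Nat.coprime_primes (Nat.prime_of_mem_primeFactors p.2) (Nat.prime_of_mem_primeFactors q.2)).2
      fun h => hpq (Subtype.ext h)
  have hprod : ∏ p : g.primeFactors, (p : ℕ) = g := by
    rw [Finset.prod_coe_sort g.primeFactors (fun p => p), Nat.prod_primeFactors_of_squarefree hg]
  let e : ZMod g ≃+* ∀ p : g.primeFactors, ZMod p :=
    (ZMod.ringEquivCongr hprod.symm).trans (ZMod.prodEquivPi _ hpi)
  let E : {e : ZMod g // e * e = e} ≃ ∀ p : g.primeFactors, {e : ZMod p // e * e = e} :=
    (e.toEquiv.subtypeEquiv (q := fun f => ∀ p, f p * f p = f p) fun x => by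
      rw [← e.injective.eq_iff, map_mul]
      exact funext_iff).trans
      (Equiv.subtypePiEquivPi (p := fun (p : g.primeFactors) (e : ZMod p) => e * e = e))
  rw [Nat.card_congr E, Nat.card_pi]
  have h2 (p : g.primeFactors) : Nat.card {e : ZMod p // e * e = e} = 2 := by
    have : Fact (p : ℕ).Prime := ⟨Nat.prime_of_mem_primeFactors p.2⟩
    have h3 : {e : ZMod p | e * e = e} = {0, 1} := by
      ext e
      simp only [Set.mem_ofPred_eq, Set.mem_insert_iff, Set.mem_singleton_iff]
      exact IsIdempotentElem.iff_eq_zero_or_one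
    have h4 : Nat.card {e : ZMod p | e * e = e} = 2 := by
      rw [h3, Nat.card_coe_set_eq, Set.ncard_pair zero_ne_one]
    exact h4
  simp only [h2, Finset.prod_const, Finset.card_univ, Fintype.card_coe]
  rw [ArithmeticFunction.cardDistinctFactors_apply, ← List.card_toFinset]
  rfl

/-- Solutions correspond to idempotents by u = 1 + e(κ⁻¹ - 1), where e marks the primes at which u =
κ⁻¹. Since κ - 1 is a unit, e = -(u - 1)κ/(κ - 1) inverts this. -/
theorem ZMod.card_units_mul_eq_zero {g : ℕ} (hg : Squarefree g) {κ : (ZMod g)ˣ}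
    (hκ : IsUnit ((κ : ZMod g) - 1)) :
    Nat.card {u : (ZMod g)ˣ // ((u : ZMod g) - 1) * (u * κ - 1) = 0} =
      2 ^ ArithmeticFunction.cardDistinctFactors g := by
  rw [← ZMod.card_idempotents hg]
  obtain ⟨v, hv⟩ := hκ
  let κ' : ZMod g := (κ⁻¹ : (ZMod g)ˣ)
  have h1 : (κ : ZMod g) * κ' = 1 := κ.mul_inv
  let v' : ZMod g := (v⁻¹ : (ZMod g)ˣ)
  have h2 : ((κ : ZMod g) - 1) * v' = 1 := by rw [← hv]; exact v.mul_inv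
  have hu (e : ZMod g) (he : e * e = e) : (1 + e * (κ' - 1)) * (1 + e * (κ - 1)) = 1 := by
    linear_combination ((κ' - 1) * (κ - 1)) * he + e * h1
  refine Nat.card_congr
    { toFun := fun u => ⟨- (u.1 - 1) * κ * v', ?_⟩
      invFun := fun e => ⟨⟨1 + e.1 * (κ' - 1), 1 + e.1 * (κ - 1), hu _ e.2, by
        rw [mul_comm]; exact hu _ e.2⟩, ?_⟩
      left_inv := fun u => ?_
      right_inv := fun e => ?_ }
  · have h3 := u.2
    linear_combination (κ * v' ^ 2) * h3 - (u.1 - 1) * κ * v' * h2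
  · have h3 := e.2
    simp only
    linear_combination ((κ' - 1) * (1 - κ)) * h3 + (e.1 ^2 * (κ' - 1) * 1 ) * h1 
  · ext
    simp only
    linear_combination (u.1 - 1 : ZMod g) * h2 - (u.1 - 1 : ZMod g) * v' * h1
  · ext
    simp only
    linear_combination e.1 * h2 - e.1 * v' * h1

/-! ### The metacyclic structure of groups of squarefree order -/

open Multiplicative
open scoped commutatorElement

/-- A finite group of squarefree order `g * m` whose commutator subgroup is cyclic of order `g`, with
cyclic abelianization of order `m`; `ι` parametrizes the commutator subgroup and `χ` records the
action of automorphisms on it. -/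
structure MetacyclicData (G : Type*) [Group G] (g m : ℕ) where
  /-- The parametrization of the commutator subgroup. -/
  ι : Multiplicative (ZMod g) →* G
  /-- The exponent by which an automorphism acts on the commutator subgroup. -/
  χ : MulAut G →* (ZMod g)ˣ
  injective : Function.Injective ι
  range_eq : ι.range = commutator G
  map_ι : ∀ f x, f (ι (ofAdd x)) = ι (ofAdd (χ f * x))
  isCyclic : IsCyclic (Abelianization G)
  card_abelianization : Nat.card (Abelianization G) = m
  squarefree : Squarefree (g * m)

namespace MetacyclicData

theorem nonempty_of_squarefree {G : Type*} [Group G] (hG : Squarefree (Nat.card G)) :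
    Nonempty (MetacyclicData G (Nat.card (commutator G)) (Nat.card (Abelianization G))) := by
  have hfin : Finite G := Nat.finite_of_card_ne_zero hG.ne_zero
  have hZ : IsZGroup G := IsZGroup.of_squarefree hG
  have hC : IsCyclic (commutator G) := IsZGroup.isCyclic_commutator G
  set g := Nat.card (commutator G)
  let E : Multiplicative (ZMod g) ≃* commutator G := zmodCyclicMulEquiv hC
  let ι : Multiplicative (ZMod g) →* G := (commutator G).subtype.comp E.toMonoidHom
  have hιE (x) : ι x = E x := rfl
  have hinj : Function.Injective ι := Subtype.val_injective.comp E.injective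
  have hrange : ι.range = commutator G := by
    ext x
    constructor
    · rintro ⟨y, rfl⟩; exact (E y).2
    · intro hx; exact ⟨E.symm ⟨x, hx⟩, by rw [hιE, E.apply_symm_apply]⟩
  have hex (f : MulAut G) : ∃ u : ZMod g, ∀ x, f (ι (ofAdd x)) = ι (ofAdd (u * x)) := by
    have hmem (y) : f (ι y) ∈ ι.range := by
      rw [hrange]
      have h1 : ι y ∈ commutator G := hrange ▸ ⟨y, rfl⟩
      have h2 := Subgroup.mem_map_of_mem f.toMonoidHom h1
      rw [Subgroup.characteristic_iff_map_eq.1 inferInstance f] at h2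
      exact h2
    obtain ⟨u, hu⟩ := hmem (ofAdd 1)
    refine ⟨u.toAdd, fun x => ?_⟩
    have : NeZero g := ⟨Nat.card_pos.ne'⟩
    have h1 : ofAdd x = (ofAdd (1 : ZMod g)) ^ x.val := by
      rw [← ofAdd_nsmul]; simp
    have h2 : ofAdd (u.toAdd * x) = u ^ x.val := by
      rw [← ofAdd_toAdd u, ← ofAdd_nsmul]; simp [mul_comm]
    rw [h1, map_pow, map_pow, ← hu, h2, map_pow]
  choose c hc using hex
  have huniq (f : MulAut G) (u : ZMod g) (h : f (ι (ofAdd 1)) = ι (ofAdd u)) : c f = u := by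
    have := hinj ((hc f 1).symm.trans h)
    simpa using this
  let χ' : MulAut G →* ZMod g :=
    { toFun := c
      map_one' := huniq _ _ rfl
      map_mul' := fun f k => huniq _ _ (by
        rw [MulAut.mul_apply, hc, hc]; simp) }
  -- The exponents are units because automorphisms form a group.
  refine ⟨⟨ι, χ'.toHomUnits, hinj, hrange, hc, inferInstance, rfl, ?_⟩⟩
  have : Nat.card (Abelianization G) = (commutator G).index := rfl
  rwa [this, Subgroup.card_mul_index]

variable {G : Type*} [Group G] {g m : ℕ} (D : MetacyclicData G g m)
include D

theorem squarefree_left : Squarefree g := D.squarefree.of_mul_left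
theorem squarefree_right : Squarefree m := D.squarefree.of_mul_right
theorem coprime : g.Coprime m := Nat.coprime_of_squarefree_mul D.squarefree
theorem neZero : NeZero g := ⟨D.squarefree_left.ne_zero⟩

theorem card_eq : Nat.card G = g * m := by
  rw [← Subgroup.card_mul_index (commutator G), ← D.range_eq]
  have h1 : Nat.card D.ι.range = g := by
    rw [← Nat.card_congr (MonoidHom.ofInjective D.injective).toEquiv]
    exact Nat.card_zmod g
  rw [h1, D.range_eq]
  exact congrArg _ D.card_abelianization

theorem finite : Finite G :=
  Nat.finite_of_card_ne_zero (by rw [D.card_eq]; exact D.squarefree.ne_zero)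

/-- The parametrization of the commutator subgroup, written additively. -/
def j (x : ZMod g) : G := D.ι (ofAdd x)

theorem j_add (x y : ZMod g) : D.j (x + y) = D.j x * D.j y := D.ι.map_mul _ _
theorem j_zero : D.j 0 = 1 := D.ι.map_one
theorem j_inj {x y : ZMod g} : D.j x = D.j y ↔ x = y :=
  ⟨fun h => D.injective h, fun h => by rw [h]⟩
theorem map_j (f : MulAut G) (x : ZMod g) : f (D.j x) = D.j (D.χ f * x) := D.map_ι f x
theorem mem_commutator {x : G} : x ∈ commutator G ↔ ∃ y, D.j y = x := by
  rw [← D.range_eq]; exact Iff.rfl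
theorem of_j (x : ZMod g) : Abelianization.of (D.j x) = 1 := by
  rw [← MonoidHom.mem_ker, Abelianization.ker_of, D.mem_commutator]; exact ⟨x, rfl⟩
theorem exists_of_eq {x y : G} (h : Abelianization.of x = Abelianization.of y) :
    ∃ t, x = D.j t * y := by
  have h1 : x * y⁻¹ ∈ commutator G := by
    rw [← Abelianization.ker_of, MonoidHom.mem_ker, map_mul, map_inv, h, mul_inv_cancel]
  obtain ⟨t, ht⟩ := D.mem_commutator.1 h1
  exact ⟨t, by rw [ht]; group⟩

/-- The exponent by which an element acts on the commutator subgroup by conjugation. -/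
def κ : G →* (ZMod g)ˣ := D.χ.comp MulAut.conj

theorem mul_j (a : G) (x : ZMod g) : a * D.j x = D.j (D.κ a * x) * a := by
  have := D.map_j (MulAut.conj a) x
  rw [MulAut.conj_apply] at this
  rw [← mul_inv_eq_iff_eq_mul, this]; rfl

theorem pow_mul_j (a : G) (i : ℕ) (x : ZMod g) :
    a ^ i * D.j x = D.j ((D.κ a : ZMod g) ^ i * x) * a ^ i := by
  rw [mul_j, map_pow, Units.val_pow_eq_pow_val]

theorem κ_j (x : ZMod g) : D.κ (D.j x) = 1 := by
  ext
  have h := D.mul_j (D.j x) 1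
  rw [← D.j_add, ← D.j_add, D.j_inj] at h
  rw [mul_one, add_comm] at h
  simpa using (add_right_cancel h).symm

/-- An element generating the abelianization. -/
def Gen (_ : MetacyclicData G g m) (a : G) : Prop :=
  ∀ x : Abelianization G, ∃ i : ℕ, Abelianization.of a ^ i = x

variable {D} {a : G} (ha : D.Gen a)
include ha

theorem Gen.exists_eq (x : G) : ∃ (y : ZMod g) (i : ℕ), x = D.j y * a ^ i := by
  obtain ⟨i, hi⟩ := ha (Abelianization.of x)
  obtain ⟨y, hy⟩ := D.exists_of_eq (x := x) (y := a ^ i) (by rw [map_pow, hi])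
  exact ⟨y, i, hy⟩

theorem Gen.j_mul (x : ZMod g) : D.Gen (D.j x * a) := fun y => by
  obtain ⟨i, hi⟩ := ha y
  exact ⟨i, by rw [map_mul, D.of_j, one_mul, hi]⟩

theorem Gen.orderOf_of : orderOf (Abelianization.of a) = m := by
  rw [← D.card_abelianization]
  refine orderOf_eq_card_of_forall_mem_zpowers fun x => ?_
  obtain ⟨i, hi⟩ := ha x
  exact ⟨i, by simpa using hi⟩

/-- Every commutator lies in j((κ - 1)ℤ/g). As commutators generate all of G', the element j(1) lies
there too, so κ - 1 divides 1. -/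
theorem Gen.isUnit_sub_one : IsUnit ((D.κ a : ZMod g) - 1) := by
  have := D.neZero
  let B : AddSubgroup (ZMod g) := (AddMonoidHom.mulLeft ((D.κ a : ZMod g) - 1)).range
  let B' : Subgroup G := (AddSubgroup.toSubgroup B).map D.ι
  have hB' (r : ZMod g) : D.j (((D.κ a : ZMod g) - 1) * r) ∈ B' := ⟨_, ⟨r, rfl⟩, rfl⟩
  have hle : commutator G ≤ B' := by
    rw [commutator_def, Subgroup.commutator_le]
    rintro x - y -
    obtain ⟨s, i, rfl⟩ := ha.exists_eq x
    obtain ⟨t, k, rfl⟩ := ha.exists_eq y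
    obtain ⟨r, hr⟩ := sub_dvd_pow_sub_pow (D.κ a : ZMod g) 1 i
    obtain ⟨r', hr'⟩ := sub_dvd_pow_sub_pow (D.κ a : ZMod g) 1 k
    rw [one_pow] at hr hr'
    have h1 : ⁅D.j s * a ^ i, D.j t * a ^ k⁆ =
        D.j (((D.κ a : ZMod g) - 1) * (r * t - r' * s)) := by
      rw [commutatorElement_def, mul_inv_eq_iff_eq_mul, mul_inv_eq_iff_eq_mul]
      have e1 : D.j s * a ^ i * (D.j t * a ^ k) = D.j (s + (D.κ a : ZMod g) ^ i * t) * a ^ (i + k) := by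
        rw [D.j_add, pow_add, mul_assoc, ← mul_assoc (a ^ i), D.pow_mul_j]; group
      have e2 (v) : D.j v * (D.j t * a ^ k) * (D.j s * a ^ i) =
          D.j (v + t + (D.κ a : ZMod g) ^ k * s) * a ^ (i + k) := by
        rw [D.j_add, D.j_add, add_comm i, pow_add, mul_assoc, mul_assoc, ← mul_assoc (a ^ k), D.pow_mul_j]
        group
      rw [e1, e2]
      congr 2
      linear_combination t * hr - s * hr'
    rw [h1]; exact hB' _
  have h1 : D.j 1 ∈ B' := hle (D.mem_commutator.2 ⟨1, rfl⟩)
  obtain ⟨x, ⟨r, hr⟩, hx⟩ := h1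
  have h2 : ((D.κ a : ZMod g) - 1) * r = 1 := by
    have := D.injective hx
    rw [this] at hr
    exact hr
  exact IsUnit.of_mul_eq_one _ h2

/-- The element a^m = j(t) commutes with `a`, so (κ - 1)t = 0 and t = 0. Thus `a` generates a
complement to G'. -/
theorem Gen.pow_eq_one : a ^ m = 1 := by
  obtain ⟨t, ht⟩ := D.exists_of_eq (x := a ^ m) (y := 1) (by
    rw [map_pow, ← ha.orderOf_of, pow_orderOf_eq_one, map_one])
  rw [mul_one] at ht
  have h1 := D.mul_j a t
  rw [← ht, ← pow_succ', pow_succ, ht] at h1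
  have h2 := D.j_inj.1 (mul_right_cancel h1)
  have h3 : ((D.κ a : ZMod g) - 1) * t = 0 := by linear_combination -h2
  rw [ht, ha.isUnit_sub_one.mul_right_eq_zero.1 h3, D.j_zero]

theorem Gen.κ_pow_eq_one : (D.κ a : ZMod g) ^ m = 1 := by
  rw [← Units.val_pow_eq_pow_val, ← map_pow, ha.pow_eq_one, map_one, Units.val_one]

theorem Gen.of_pow_eq_one_iff {i : ℕ} : Abelianization.of a ^ i = 1 ↔ m ∣ i := by
  rw [← ha.orderOf_of, orderOf_dvd_iff_pow_eq_one]

theorem Gen.orderOf_eq : orderOf a = m := by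
  apply Nat.dvd_antisymm (orderOf_dvd_of_pow_eq_one ha.pow_eq_one)
  rw [← ha.of_pow_eq_one_iff, ← map_pow, pow_orderOf_eq_one, map_one]

theorem Gen.j_mul_pow_inj {x y : ZMod g} {i k : ℕ} :
    D.j x * a ^ i = D.j y * a ^ k ↔ x = y ∧ i ≡ k [MOD m] := by
  have ho := ha.orderOf_eq
  constructor
  · intro h
    have h1 : i ≡ k [MOD m] := by
      have h2 := congrArg Abelianization.of h
      rw [map_mul, map_mul, D.of_j, D.of_j, one_mul, one_mul, map_pow, map_pow,
        pow_eq_pow_iff_modEq, ha.orderOf_of] at h2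
      exact h2
    refine ⟨?_, h1⟩
    rw [← ho] at h1
    rw [pow_eq_pow_iff_modEq.2 h1] at h
    exact D.j_inj.1 (mul_right_cancel h)
  · rintro ⟨rfl, h⟩
    rw [← ho] at h
    rw [pow_eq_pow_iff_modEq.2 h]

/-- Automorphisms are determined by arbitrary compatible values on generators. -/
theorem Gen.exists_mulAut {b : G} (hb : D.Gen b) (hab : D.κ a = D.κ b) (r : (ZMod g)ˣ) :
    ∃ f : MulAut G, f a = b ∧ D.χ f = r := by
  have := D.finite
  choose Y I hYI using ha.exists_eq
  let F : G → G := fun x => D.j (r * Y x) * b ^ I x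
  -- The value of `F` does not depend on the chosen normal form, since i matters only modulo m for
  -- both `a` and `b`.
  have hF (y : ZMod g) (i : ℕ) : F (D.j y * a ^ i) = D.j (r * y) * b ^ i := by
    have h1 := hYI (D.j y * a ^ i)
    rw [ha.j_mul_pow_inj] at h1
    exact hb.j_mul_pow_inj.2 ⟨by rw [← h1.1], h1.2.symm⟩
  have hmul (x y : G) : F (x * y) = F x * F y := by
    obtain ⟨s, i, rfl⟩ := ha.exists_eq x
    obtain ⟨t, k, rfl⟩ := ha.exists_eq y
    have e1 (c : G) (s t : ZMod g) : D.j s * c ^ i * (D.j t * c ^ k) = D.j (s + (D.κ c : ZMod g) ^ i * t) * c ^ (i + k) := by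
      rw [D.j_add, pow_add, mul_assoc, ← mul_assoc (c ^ i), D.pow_mul_j]; group
    rw [e1, hF, hF, hF, e1, hab]
    congr 2; ring
  have hsurj : Function.Surjective F := fun x => by
    obtain ⟨s, i, rfl⟩ := hb.exists_eq x
    refine ⟨D.j ((r⁻¹ : (ZMod g)ˣ) * s) * a ^ i, ?_⟩
    rw [hF, Units.mul_inv_cancel_left]
  let f : MulAut G := MulEquiv.ofBijective (MonoidHom.mk' F hmul)
    (Finite.injective_iff_bijective.1 (Finite.injective_iff_surjective.2 hsurj))
  have hf (x) : f x = F x := rfl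
  refine ⟨f, ?_, ?_⟩
  · have := hF 0 1
    simpa [D.j_zero, hf] using this
  · ext
    have h1 := D.map_j f 1
    have h2 := hF 1 0
    rw [pow_zero, pow_zero, mul_one, mul_one, ← hf, h1, D.j_inj] at h2
    simpa using h2

end MetacyclicData

/-- An affine permutation of a cyclic group of squarefree order with a single orbit is a
translation. -/
theorem MulEquiv.apply_eq_of_affine_orbit {C : Type*} [CommGroup C] [hC : IsCyclic C]
    (hsq : Squarefree (Nat.card C)) (α : C ≃* C) {a : C} {x : ℕ → C} (h0 : x 0 = 1)
    (hx : ∀ i, x (i + 1) = a * α (x i)) (hs : Function.Surjective x) (c : C) : α c = c := by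
  set N := Nat.card C
  have : NeZero N := ⟨hsq.ne_zero⟩
  let E : Multiplicative (ZMod N) ≃* C := zmodCyclicMulEquiv hC
  let k : ZMod N := toAdd (E.symm (α (E (ofAdd 1))))
  have hk (y : C) : toAdd (E.symm (α y)) = k * toAdd (E.symm y) := by
    obtain ⟨y, rfl⟩ := E.surjective y
    have h1 : y = (ofAdd (1 : ZMod N)) ^ y.toAdd.val := by
      rw [← ofAdd_nsmul]; simp
    rw [E.symm_apply_apply]
    conv_lhs => rw [h1]
    rw [map_pow, map_pow, map_pow, toAdd_pow]
    simp [k, mul_comm]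
  have hunit : IsUnit k := by
    obtain ⟨y, hy⟩ := α.surjective (E (ofAdd 1))
    have := hk y
    rw [hy, E.symm_apply_apply, toAdd_ofAdd] at this
    exact IsUnit.of_mul_eq_one _ this.symm
  have h1 : k = 1 := by
    refine ZMod.eq_one_of_affine_orbit hsq hunit (a := toAdd (E.symm a))
      (x := fun i => toAdd (E.symm (x i))) (by simp [h0]) (fun i => ?_) ?_
    · rw [hx, map_mul, toAdd_mul, hk]
    · exact toAdd.surjective.comp (E.symm.surjective.comp hs)
  have := hk c
  rw [h1, one_mul] at this
  exact E.symm.injective this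

theorem card_generators {U : Type*} [CommGroup U] [Finite U] (H : Subgroup U) [hH : IsCyclic H] :
    Nat.card {x : U // Subgroup.zpowers x = H} = Nat.totient (Nat.card H) := by
  classical
  cases nonempty_fintype U
  have h1 (x : U) : Subgroup.zpowers x = H ↔ ∃ h : x ∈ H, orderOf (⟨x, h⟩ : H) = Nat.card H := by
    constructor
    · rintro rfl
      exact ⟨Subgroup.mem_zpowers x, by rw [Subgroup.orderOf_mk, Nat.card_zpowers]⟩
    · rintro ⟨h, hx⟩
      rw [Subgroup.orderOf_mk] at hx
      exact Subgroup.eq_of_le_of_card_ge (Subgroup.zpowers_le.2 h) (by rw [Nat.card_zpowers, hx])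
  have h2 := IsCyclic.card_orderOf_eq_totient (α := H) (d := Fintype.card H) dvd_rfl
  rw [Nat.card_eq_fintype_card (α := H), ← h2, ← Fintype.card_subtype, ← Nat.card_eq_fintype_card]
  refine Nat.card_congr
    { toFun := fun x => ⟨⟨x.1, ((h1 _).1 x.2).1⟩, by
        rw [← Nat.card_eq_fintype_card]; exact ((h1 _).1 x.2).2⟩
      invFun := fun x => ⟨x.1.1, (h1 _).2 ⟨x.1.2, by rw [Nat.card_eq_fintype_card]; exact x.2⟩⟩
      left_inv := fun _ => rfl
      right_inv := fun _ => rfl }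

theorem Abelianization.of_surjective {G : Type*} [Group G] :
    Function.Surjective (Abelianization.of : G →* Abelianization G) :=
  QuotientGroup.mk_surjective

theorem IsCocycle.trans_mulEquiv {Γ G G' : Type*} [Group Γ] [Group G] [Group G'] {φ : Γ ≃ G}
    (hφ : IsCocycle φ) (e : G ≃* G') : IsCocycle (φ.trans e.toEquiv) := fun γ => by
  obtain ⟨f, hf⟩ := hφ γ
  exact ⟨(e.symm.trans f).trans e, fun δ => by simp [hf]⟩

/-- Isomorphic groups have the same bijective cocycles up to automorphisms. -/
def IsCocycle.quotientCongr (Γ : Type*) {G G' : Type*} [Group Γ] [Group G] [Group G'] (e : G ≃* G') :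
    Quotient (IsCocycle.setoid Γ G) ≃ Quotient (IsCocycle.setoid Γ G') :=
  Quotient.congr
    { toFun := fun φ => ⟨φ.1.trans e.toEquiv, φ.2.trans_mulEquiv e⟩
      invFun := fun φ => ⟨φ.1.trans e.symm.toEquiv, φ.2.trans_mulEquiv e.symm⟩
      left_inv := fun φ => by ext; simp
      right_inv := fun φ => by ext; simp } fun φ ψ => by
    constructor
    · rintro ⟨f, hf⟩
      exact ⟨(e.symm.trans f).trans e, fun γ => by simp [hf]⟩
    · rintro ⟨f, hf⟩
      refine ⟨(e.trans f).trans e.symm, fun γ => ?_⟩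
      have h : e (ψ.1 γ) = f (e (φ.1 γ)) := hf γ
      simp [← h]

/-! ### The centre, and counting the pairs (κ, u) -/

namespace MetacyclicData

variable {G : Type*} [Group G] {g m : ℕ} (D : MetacyclicData G g m)

theorem gen_of_orderOf {a : G} (h : orderOf (Abelianization.of a) = m) : D.Gen a := by
  have := D.finite
  have : Finite (Abelianization G) := Finite.of_surjective _ Abelianization.of_surjective
  have htop : Subgroup.zpowers (Abelianization.of a) = ⊤ :=
    Subgroup.eq_top_of_card_eq _ (by rw [Nat.card_zpowers, h, D.card_abelianization])
  intro x
  have hx : x ∈ Subgroup.zpowers (Abelianization.of a) := htop ▸ Subgroup.mem_top x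
  exact mem_powers_iff_mem_zpowers.2 hx

theorem exists_gen : ∃ a, D.Gen a := by
  have := D.isCyclic
  obtain ⟨x, hx⟩ := IsCyclic.exists_generator (α := Abelianization G)
  obtain ⟨a, rfl⟩ := Abelianization.of_surjective x
  exact ⟨a, D.gen_of_orderOf (by rw [orderOf_eq_card_of_forall_mem_zpowers hx, D.card_abelianization])⟩

variable {D} {a : G}

theorem Gen.κ_range (ha : D.Gen a) : D.κ.range = Subgroup.zpowers (D.κ a) := by
  apply le_antisymm
  · rintro _ ⟨x, rfl⟩
    obtain ⟨y, i, rfl⟩ := ha.exists_eq x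
    rw [map_mul, D.κ_j, one_mul, map_pow]
    exact Subgroup.npow_mem_zpowers _ i
  · rw [Subgroup.zpowers_le]; exact ⟨a, rfl⟩

/-- Write x = j(y)a^i. Commuting with `a` forces (κ - 1)y = 0, so y = 0; commuting with j(1) forces
κ^i = 1. -/
theorem Gen.mem_center_iff (ha : D.Gen a) {x : G} :
    x ∈ Subgroup.center G ↔ ∃ i : ℕ, D.κ a ^ i = 1 ∧ a ^ i = x := by
  constructor
  · intro hx
    obtain ⟨y, i, rfl⟩ := ha.exists_eq x
    rw [Subgroup.mem_center_iff] at hx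
    have h1 := hx a
    rw [← mul_assoc, D.mul_j, mul_assoc, mul_assoc, ← pow_succ, ← pow_succ'] at h1
    have h2 := (ha.j_mul_pow_inj.1 h1).1
    have h3 : ((D.κ a : ZMod g) - 1) * y = 0 := by linear_combination h2
    have hy := ha.isUnit_sub_one.mul_right_eq_zero.1 h3
    subst hy
    rw [D.j_zero, one_mul] at hx ⊢
    refine ⟨i, ?_, rfl⟩
    have h4 := hx (D.j 1)
    rw [D.pow_mul_j] at h4
    have h5 := D.j_inj.1 (mul_right_cancel h4)
    ext
    simpa using h5.symm
  · rintro ⟨i, hi, rfl⟩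
    rw [Subgroup.mem_center_iff]
    intro y
    obtain ⟨t, k, rfl⟩ := ha.exists_eq y
    rw [← mul_assoc, D.pow_mul_j, ← Units.val_pow_eq_pow_val, hi, Units.val_one, one_mul, mul_assoc,
      mul_assoc, ← pow_add, ← pow_add, add_comm]

theorem Gen.card_center_mul (ha : D.Gen a) :
    Nat.card (Subgroup.center G) * Nat.card D.κ.range = m := by
  have := D.finite
  rw [ha.κ_range, Nat.card_zpowers]
  have hd : orderOf (D.κ a) ∣ m := by
    rw [orderOf_dvd_iff_pow_eq_one]; ext; simpa using ha.κ_pow_eq_one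
  have h1 : Subgroup.center G = Subgroup.zpowers (a ^ orderOf (D.κ a)) := by
    ext x
    rw [ha.mem_center_iff, ← mem_powers_iff_mem_zpowers]
    constructor
    · rintro ⟨i, hi, rfl⟩
      obtain ⟨k, rfl⟩ := orderOf_dvd_of_pow_eq_one hi
      exact ⟨k, by simp [pow_mul]⟩
    · rintro ⟨k, rfl⟩
      exact ⟨orderOf (D.κ a) * k, by rw [pow_mul, pow_orderOf_eq_one, one_pow], by simp [pow_mul]⟩
  rw [h1, Nat.card_zpowers, orderOf_pow, ha.orderOf_eq, Nat.gcd_eq_right hd, Nat.div_mul_cancel hd]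

variable (D)

theorem exists_gen_κ_eq {k : (ZMod g)ˣ} (hk : Subgroup.zpowers k = D.κ.range) :
    ∃ a, D.Gen a ∧ D.κ a = k := by
  have := D.finite
  have := D.neZero
  have : NeZero m := ⟨D.squarefree_right.ne_zero⟩
  obtain ⟨a, ha⟩ := D.exists_gen
  rw [ha.κ_range] at hk
  have hd : orderOf (D.κ a) ∣ m := by
    rw [orderOf_dvd_iff_pow_eq_one]; ext; simpa using ha.κ_pow_eq_one
  have hmem : k ∈ Subgroup.zpowers (D.κ a) := hk ▸ Subgroup.mem_zpowers k
  obtain ⟨i, rfl⟩ := mem_powers_iff_mem_zpowers.2 hmem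
  have ho : orderOf (D.κ a ^ i) = orderOf (D.κ a) := by
    rw [← Nat.card_zpowers, ← Nat.card_zpowers]; exact congrArg (fun H : Subgroup _ => Nat.card H) hk
  have hcop : i.Coprime (orderOf (D.κ a)) := by
    rw [orderOf_pow] at ho
    have hpos := orderOf_pos (D.κ a)
    rw [Nat.coprime_comm]
    rcases Nat.div_eq_self.1 ho with h | h
    · exact absurd h hpos.ne'
    · exact h
  -- The exponent i is prime to the order of κ, but a^i need not generate modulo G'. It is replaced
  -- by a congruent exponent prime to m.
  obtain ⟨v, hv⟩ := ZMod.unitsMap_surjective hd (ZMod.unitOfCoprime i hcop)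
  have hv' : ((v : ZMod m).val : ZMod (orderOf (D.κ a))) = i := by
    have := congrArg Units.val hv
    rw [ZMod.unitsMap_val, ZMod.coe_unitOfCoprime, ZMod.cast_eq_val] at this
    exact this
  refine ⟨a ^ (v : ZMod m).val, D.gen_of_orderOf ?_, ?_⟩
  · rw [map_pow, orderOf_pow, ha.orderOf_of]
    have : m.gcd (v : ZMod m).val = 1 := (ZMod.val_coe_unit_coprime v).symm
    rw [this, Nat.div_one]
  · rw [map_pow]
    exact pow_eq_pow_iff_modEq.2 ((ZMod.natCast_eq_natCast_iff _ _ _).1 hv')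

theorem card_parameters :
    Nat.card {p : (ZMod g)ˣ × (ZMod g)ˣ // Subgroup.zpowers p.1 = D.κ.range ∧
      ((p.2 : ZMod g) - 1) * (p.2 * p.1 - 1) = 0} =
    2 ^ ArithmeticFunction.cardDistinctFactors g * Nat.totient (Nat.card D.κ.range) := by
  have := D.neZero
  have hcyc : IsCyclic D.κ.range := by
    obtain ⟨a, ha⟩ := D.exists_gen
    rw [ha.κ_range]; infer_instance
  let e : {p : (ZMod g)ˣ × (ZMod g)ˣ // Subgroup.zpowers p.1 = D.κ.range ∧
      ((p.2 : ZMod g) - 1) * (p.2 * p.1 - 1) = 0} ≃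
      Σ k : {k : (ZMod g)ˣ // Subgroup.zpowers k = D.κ.range},
        {u : (ZMod g)ˣ // ((u : ZMod g) - 1) * (u * k.1 - 1) = 0} :=
    { toFun := fun p => ⟨⟨p.1.1, p.2.1⟩, ⟨p.1.2, p.2.2⟩⟩
      invFun := fun p => ⟨(p.1.1, p.2.1), p.1.2, p.2.2⟩
      left_inv := fun _ => rfl
      right_inv := fun _ => rfl }
  classical
  rw [Nat.card_congr e, Nat.card_sigma]
  have h1 (k : {k : (ZMod g)ˣ // Subgroup.zpowers k = D.κ.range}) :
      Nat.card {u : (ZMod g)ˣ // ((u : ZMod g) - 1) * (u * k.1 - 1) = 0} =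
      2 ^ ArithmeticFunction.cardDistinctFactors g := by
    obtain ⟨a, ha, hak⟩ := D.exists_gen_κ_eq k.2
    exact ZMod.card_units_mul_eq_zero D.squarefree_left (hak ▸ ha.isUnit_sub_one)
  simp only [h1, Finset.sum_const, Finset.card_univ, smul_eq_mul]
  rw [← Nat.card_eq_fintype_card, card_generators, mul_comm]

variable {D}

/-- Here α^i(a) = j(t(1 + u + ⋯ + u^(i-1)))a. Moving these factors left past powers of `a` brings in
powers of κ, whence the iterated sum. -/
theorem eq_j_mul_pow {α : MulAut G} {t : ZMod g} (hα : α a = D.j t * a) {x : ℕ → G} (h0 : x 0 = 1)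
    (hx : ∀ i, x (i + 1) = x i * (α ^ i) a) (i : ℕ) :
    x i = D.j (t * iteratedGeomSum (D.κ a : ZMod g) (D.χ α) i) * a ^ i := by
  have hpow (i : ℕ) : (α ^ i) a = D.j (t * ∑ l ∈ Finset.range i, (D.χ α : ZMod g) ^ l) * a := by
    induction i with
    | zero => simp [D.j_zero]
    | succ i ih =>
      rw [pow_succ', MulAut.mul_apply, ih, map_mul, D.map_j, hα, ← mul_assoc, ← D.j_add,
        Finset.sum_range_succ']
      simp only [pow_succ', ← Finset.mul_sum, pow_zero]
      congr 2; ring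
  induction i with
  | zero => simp [h0, iteratedGeomSum, D.j_zero]
  | succ i ih =>
    have hS : iteratedGeomSum (D.κ a : ZMod g) (D.χ α) (i + 1) =
      iteratedGeomSum (D.κ a : ZMod g) (D.χ α) i +
        (D.κ a : ZMod g) ^ i * ∑ l ∈ Finset.range i, (D.χ α : ZMod g) ^ l :=
      Finset.sum_range_succ _ _
    rw [hx, ih, hpow, mul_assoc, ← mul_assoc (a ^ i), D.pow_mul_j, mul_assoc, ← pow_succ, ← mul_assoc,
      ← D.j_add, hS]
    congr 2; ring

/-! ### Classifying bijective crossed homomorphisms from a cyclic group -/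

section Cocycle

variable {Γ : Type*} [Group Γ] {σ : Γ} {φ : Γ ≃ G} (hφ : IsCocycle φ)

theorem _root_.IsCocycle.map_pow_succ (i : ℕ) :
    φ (σ ^ (i + 1)) = φ (σ ^ i) * (hφ.action σ ^ i) (φ σ) := by
  rw [pow_succ, hφ.map_mul, hφ.action.map_pow]

/-- In G/G' the images of φ(σ^i) form a surjective affine orbit, so α acts trivially there and the
orbit consists of the powers of φ(σ). -/
theorem gen_of_isCocycle (hσ : ∀ γ : Γ, ∃ i : ℕ, σ ^ i = γ) :
    D.Gen (φ σ) ∧ ∃ t, hφ.action σ (φ σ) = D.j t * φ σ := by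
  have := D.isCyclic
  let α : Abelianization G ≃* Abelianization G := MulEquiv.abelianizationCongr (hφ.action σ)
  have hα (x : G) : α (Abelianization.of x) = Abelianization.of (hφ.action σ x) := rfl
  let x : ℕ → Abelianization G := fun i => Abelianization.of (φ (σ ^ i))
  have h0 : x 0 = 1 := by simp [x, hφ.map_one]
  have hx (i : ℕ) : x (i + 1) = Abelianization.of (φ σ) * α (x i) := by
    simp only [x]
    rw [pow_succ', hφ.map_mul, map_mul, hα]
  have hs : Function.Surjective x := fun y => by
    obtain ⟨y, rfl⟩ := Abelianization.of_surjective y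
    obtain ⟨i, hi⟩ := hσ (φ.symm y)
    exact ⟨i, by simp [x, hi]⟩
  have hid := MulEquiv.apply_eq_of_affine_orbit
    (by rw [D.card_abelianization]; exact D.squarefree_right) α h0 hx hs
  have hxpow (i : ℕ) : x i = Abelianization.of (φ σ) ^ i := by
    induction i with
    | zero => simp [h0]
    | succ i ih => rw [hx, hid, ih, pow_succ']
  refine ⟨fun y => ?_, D.exists_of_eq ?_⟩
  · obtain ⟨i, rfl⟩ := hs y
    exact ⟨i, (hxpow i).symm⟩
  · rw [← hα, hid]

theorem isUnit_of_isCocycle (hσ : ∀ γ : Γ, ∃ i : ℕ, σ ^ i = γ) {t : ZMod g}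
    (ht : hφ.action σ (φ σ) = D.j t * φ σ) :
    IsUnit t ∧ ((D.χ (hφ.action σ) : ZMod g) - 1) *
      (D.χ (hφ.action σ) * D.κ (φ σ) - 1) = 0 := by
  have := D.neZero
  have hgen := (gen_of_isCocycle (D := D) hφ hσ).1
  set a := φ σ
  set u := D.χ (hφ.action σ)
  have hform := eq_j_mul_pow ht (x := fun i => φ (σ ^ i)) (by simp [hφ.map_one])
    (fun i => hφ.map_pow_succ i)
  -- Coordinates of φ(σ^(mk)), which are exactly the values in G'. They form an affine orbit with
  -- multiplier u^m covering ℤ/g, so u^m = 1, y k = k · y 1, and y 1 = t S_m is a unit.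
  let y : ℕ → ZMod g := fun k => t * iteratedGeomSum (D.κ a : ZMod g) u (m * k)
  have hy (k : ℕ) : φ (σ ^ (m * k)) = D.j (y k) := by
    have h1 := hform (m * k)
    rw [pow_mul a, hgen.pow_eq_one, one_pow, mul_one] at h1
    exact h1
  have hy0 : y 0 = 0 := by simp [y, iteratedGeomSum]
  have hrec (k : ℕ) : y (k + 1) = y 1 + (u : ZMod g) ^ m * y k := by
    rw [← D.j_inj, ← hy, mul_add, mul_one, add_comm, pow_add, hφ.map_mul, hy]
    have h1 := hy 1
    rw [mul_one] at h1
    rw [h1, D.map_j, map_pow, map_pow, Units.val_pow_eq_pow_val, D.j_add]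
  have hsurj : Function.Surjective y := fun c => by
    obtain ⟨i, hi⟩ := hσ (φ.symm (D.j c))
    have h1 := hform i
    simp only [hi, Equiv.apply_symm_apply] at h1
    have h2 := congrArg Abelianization.of h1
    rw [D.of_j, map_mul, D.of_j, one_mul, map_pow] at h2
    obtain ⟨k, rfl⟩ := hgen.of_pow_eq_one_iff.1 h2.symm
    refine ⟨k, ?_⟩
    rw [← D.j_inj, ← hy, hi, Equiv.apply_symm_apply]
  have hum : (u : ZMod g) ^ m = 1 :=
    ZMod.eq_one_of_affine_orbit D.squarefree_left (u.isUnit.pow m) hy0 hrec hsurj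
  have hylin (k : ℕ) : y k = k * y 1 := by
    induction k with
    | zero => simp [hy0]
    | succ k ih => rw [hrec, hum, ih]; push_cast; ring
  obtain ⟨k, hk⟩ := hsurj 1
  rw [hylin] at hk
  have hunit : IsUnit (y 1) := IsUnit.of_mul_eq_one _ ((mul_comm _ _).trans hk)
  simp only [y, mul_one] at hunit
  exact ⟨isUnit_of_mul_isUnit_left hunit, mul_eq_zero_of_isUnit_iteratedGeomSum hgen.isUnit_sub_one
    hgen.κ_pow_eq_one hum (isUnit_of_mul_isUnit_right hunit)⟩

theorem exists_mulAut_of_eq (hσ : ∀ γ : Γ, ∃ i : ℕ, σ ^ i = γ) {ψ : Γ ≃ G} (hψ : IsCocycle ψ)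
    (h1 : D.κ (φ σ) = D.κ (ψ σ)) (h2 : D.χ (hφ.action σ) = D.χ (hψ.action σ)) :
    ∃ f : MulAut G, ∀ γ, ψ γ = f (φ γ) := by
  obtain ⟨ha, t, ht⟩ := gen_of_isCocycle (D := D) hφ hσ
  obtain ⟨hb, s, hs⟩ := gen_of_isCocycle (D := D) hψ hσ
  obtain ⟨t', rfl⟩ := (isUnit_of_isCocycle hφ hσ ht).1
  obtain ⟨s', rfl⟩ := (isUnit_of_isCocycle hψ hσ hs).1
  -- Scaling G' by s'/t' turns j(t'S_i)a^i into j(s'S_i)b^i.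
  obtain ⟨f, hf, hfχ⟩ := ha.exists_mulAut hb h1 (s' * t'⁻¹)
  refine ⟨f, fun γ => ?_⟩
  obtain ⟨i, rfl⟩ := hσ γ
  rw [eq_j_mul_pow ht (x := fun i => φ (σ ^ i)) (by simp [hφ.map_one])
    (fun i => hφ.map_pow_succ i), eq_j_mul_pow hs (x := fun i => ψ (σ ^ i)) (by simp [hψ.map_one])
    (fun i => hψ.map_pow_succ i), map_mul, map_pow, hf, D.map_j, hfχ, h1, h2]
  congr 2
  rw [Units.val_mul, mul_assoc, Units.inv_mul_cancel_left]

/-- Composing with `f` conjugates both the action of σ and conjugation by φ(σ) by `f`. The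
invariants lie in the commutative group (ℤ/g)ˣ and do not change. -/
theorem eq_of_mulAut {ψ : Γ ≃ G} (hψ : IsCocycle ψ) {f : MulAut G} (hf : ∀ γ, ψ γ = f (φ γ)) :
    D.κ (φ σ) = D.κ (ψ σ) ∧ D.χ (hφ.action σ) = D.χ (hψ.action σ) := by
  have h1 : hψ.action σ = f * hφ.action σ * f⁻¹ := by
    ext x
    obtain ⟨δ, rfl⟩ := ψ.surjective x
    have h := hψ.map_mul σ δ
    rw [hf, hφ.map_mul, map_mul, hf σ] at h
    rw [← mul_left_cancel h, hf]
    simp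
  refine ⟨?_, ?_⟩
  · have h2 : MulAut.conj (f (φ σ)) = f * MulAut.conj (φ σ) * f⁻¹ := by
      ext x; simp [MulAut.conj_apply]
    rw [hf]
    simp only [κ, MonoidHom.comp_apply]
    rw [h2, map_mul, map_mul, map_inv, mul_inv_cancel_comm]
  · rw [h1, map_mul, map_mul, map_inv, mul_inv_cancel_comm]

end Cocycle

/-- A bijection from a cyclic group prescribed on the powers of a generator. -/
theorem _root_.exists_equiv_apply_pow {Γ : Type*} [Group Γ] {X : Type*} {σ : Γ} [Finite X]
    (hσ : ∀ γ : Γ, ∃ i : ℕ, σ ^ i = γ) (hcard : Nat.card Γ = Nat.card X) {x : ℕ → X}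
    (hx : ∀ i k, x i = x k ↔ i ≡ k [MOD Nat.card Γ]) [Finite Γ] : ∃ φ : Γ ≃ X, ∀ i, φ (σ ^ i) = x i := by
  have ho : orderOf σ = Nat.card Γ := orderOf_eq_card_of_forall_mem_zpowers fun γ => by
    obtain ⟨i, rfl⟩ := hσ γ
    exact Subgroup.npow_mem_zpowers _ _
  choose I hI using hσ
  have hform (i : ℕ) : x (I (σ ^ i)) = x i := by
    rw [hx, ← ho, ← pow_eq_pow_iff_modEq, hI]
  have hinj : Function.Injective fun γ => x (I γ) := fun γ δ h => by
    have h1 := (hx _ _).1 h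
    rw [← ho, ← pow_eq_pow_iff_modEq, hI, hI] at h1
    exact h1
  exact ⟨Equiv.ofBijective _ ((Nat.bijective_iff_injective_and_card _).2 ⟨hinj, hcard⟩), hform⟩

theorem exists_cocycle_of_parameters {Γ : Type*} [Group Γ] [Finite Γ] {σ : Γ}
    (hσ : ∀ γ : Γ, ∃ i : ℕ, σ ^ i = γ) (hcard : Nat.card Γ = Nat.card G) {k u : (ZMod g)ˣ}
    (hk : Subgroup.zpowers k = D.κ.range) (hu : ((u : ZMod g) - 1) * (u * k - 1) = 0) :
    ∃ (φ : Γ ≃ G) (hφ : IsCocycle φ), D.κ (φ σ) = k ∧ D.χ (hφ.action σ) = u := by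
  have := D.neZero
  have := D.finite
  obtain ⟨a, ha, rfl⟩ := D.exists_gen_κ_eq hk
  -- The normalisation t = 1, so that α(a) = j(1)a.
  obtain ⟨α, hα, rfl⟩ := ha.exists_mulAut (ha.j_mul 1) (by rw [map_mul, D.κ_j, one_mul]) u
  obtain ⟨hS, hum⟩ := ZMod.isUnit_iteratedGeomSum D.squarefree_left D.coprime ha.isUnit_sub_one
    ha.κ_pow_eq_one hu
  -- In the crossed homomorphism to be built, σ acts on `G` by x ↦ aα(x), so φ(σ^i) must be h^i(1).
  -- This is bijective because h^i(1) = 1 exactly when gm divides i.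
  let h : Equiv.Perm G := α.toEquiv.trans (Equiv.mulLeft a)
  have hh (x : G) : h x = a * α x := rfl
  have hpow (i : ℕ) (x : G) : (h ^ i) x = (h ^ i) 1 * (α ^ i) x := by
    induction i generalizing x with
    | zero => simp
    | succ i ih =>
      rw [pow_succ, Equiv.Perm.mul_apply, ih (h x), Equiv.Perm.mul_apply, ih (h 1), hh, hh, pow_succ,
        MulAut.mul_apply]
      simp [mul_assoc]
  have hsucc (i : ℕ) : (h ^ (i + 1)) 1 = (h ^ i) 1 * (α ^ i) a := by
    rw [pow_succ, Equiv.Perm.mul_apply, hpow i (h 1), hh, map_one α, mul_one]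
  have hform := eq_j_mul_pow hα (x := fun i => (h ^ i) 1) (by simp) hsucc
  simp only [one_mul] at hform
  have hmk (k : ℕ) : (h ^ (m * k)) 1 =
      D.j (k * iteratedGeomSum (D.κ a : ZMod g) (D.χ α) m) := by
    induction k with
    | zero => simp [D.j_zero]
    | succ k ih =>
      rw [mul_add, mul_one, add_comm, pow_add, Equiv.Perm.mul_apply, ih, hpow, D.map_j, map_pow,
        Units.val_pow_eq_pow_val, hum, one_mul, hform m, ha.pow_eq_one, mul_one, ← D.j_add]
      congr 1; push_cast; ring
  have hone (i : ℕ) : (h ^ i) 1 = 1 ↔ Nat.card Γ ∣ i := by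
    rw [hcard, D.card_eq]
    constructor
    · intro hi
      have h1 := congrArg Abelianization.of hi
      rw [hform i, map_mul, D.of_j, one_mul, map_pow, map_one, ha.of_pow_eq_one_iff] at h1
      obtain ⟨k, rfl⟩ := h1
      rw [hmk, ← D.j_zero, D.j_inj, hS.mul_left_eq_zero, ZMod.natCast_eq_zero_iff] at hi
      rw [mul_comm g]
      exact Nat.mul_dvd_mul_left m hi
    · rintro ⟨k, rfl⟩
      rw [mul_comm g, mul_assoc, hmk]
      simp [D.j_zero]
  have heq (i k : ℕ) : (h ^ i) 1 = (h ^ k) 1 ↔ i ≡ k [MOD Nat.card Γ] := by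
    wlog hik : i ≤ k generalizing i k
    · rw [eq_comm, this k i (le_of_not_ge hik), Nat.ModEq.comm]
    rw [Nat.modEq_iff_dvd' hik, ← hone]
    obtain ⟨l, rfl⟩ := Nat.exists_eq_add_of_le hik
    rw [pow_add, Equiv.Perm.mul_apply, (h ^ i).injective.eq_iff, Nat.add_sub_cancel_left, eq_comm]
  obtain ⟨φ, hφ⟩ := exists_equiv_apply_pow hσ hcard heq
  have hφσ : φ σ = a := by
    have := hφ 1
    rwa [pow_one, pow_one, hh, map_one, mul_one] at this
  have hcoc (i : ℕ) (δ : Γ) : φ (σ ^ i * δ) = φ (σ ^ i) * (α ^ i) (φ δ) := by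
    obtain ⟨l, rfl⟩ := hσ δ
    rw [← pow_add, hφ, hφ, hφ, pow_add, Equiv.Perm.mul_apply, hpow]
  have hc : IsCocycle φ := fun γ => by
    obtain ⟨i, rfl⟩ := hσ γ
    exact ⟨α ^ i, hcoc i⟩
  refine ⟨φ, hc, by rw [hφσ], ?_⟩
  congr 1
  ext x
  obtain ⟨δ, rfl⟩ := φ.surjective x
  have h1 := hcoc 1 δ
  rw [pow_one, pow_one, hc.map_mul] at h1
  exact mul_left_cancel h1

theorem card_quotient {Γ : Type*} [Group Γ] [IsCyclic Γ] [Finite Γ] (hcard : Nat.card Γ = Nat.card G) :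
    Nat.card (Quotient (IsCocycle.setoid Γ G)) =
      2 ^ ArithmeticFunction.cardDistinctFactors g * Nat.totient (Nat.card D.κ.range) := by
  obtain ⟨σ, hσ'⟩ := IsCyclic.exists_generator (α := Γ)
  have hσ (γ : Γ) : ∃ i : ℕ, σ ^ i = γ := mem_powers_iff_mem_zpowers.2 (hσ' γ)
  rw [← D.card_parameters]
  let F : Quotient (IsCocycle.setoid Γ G) → {p : (ZMod g)ˣ × (ZMod g)ˣ //
      Subgroup.zpowers p.1 = D.κ.range ∧ ((p.2 : ZMod g) - 1) * (p.2 * p.1 - 1) = 0} :=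
    Quotient.lift (fun φ => ⟨(D.κ (φ.1 σ), D.χ (φ.2.action σ)), by
      obtain ⟨h1, t, ht⟩ := gen_of_isCocycle (D := D) φ.2 hσ
      exact ⟨h1.κ_range.symm, (isUnit_of_isCocycle φ.2 hσ ht).2⟩⟩) <| by
      rintro φ ψ ⟨f, hf⟩
      have h := eq_of_mulAut (D := D) (σ := σ) φ.2 ψ.2 hf
      exact Subtype.ext (Prod.ext h.1 h.2)
  refine Nat.card_congr (Equiv.ofBijective F ⟨fun x y => ?_, fun p => ?_⟩)
  · induction x using Quotient.inductionOn with | _ φ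
    induction y using Quotient.inductionOn with | _ ψ
    intro h
    have h1 := congrArg Subtype.val h
    exact Quotient.sound (exists_mulAut_of_eq φ.2 hσ ψ.2 (congrArg Prod.fst h1)
      (congrArg Prod.snd h1))
  · obtain ⟨φ, hφ, h1, h2⟩ := exists_cocycle_of_parameters (D := D) hσ hcard p.2.1 p.2.2
    exact ⟨Quotient.mk _ ⟨φ, hφ⟩, Subtype.ext (Prod.ext h1 h2)⟩

end MetacyclicData

/-! ### The count of Hopf-Galois structures -/

theorem theorem1p1 {K : Type u} {L : Type v} [Field K] [Field L] [Algebra K L]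
    [IsGalois K L] [IsCyclic (L ≃ₐ[K] L)]
    (n : ℕ) (hn : Squarefree n) (hL : Module.finrank K L = n)
    {G : Type w} [Group G] (hG : Nat.card G = n)
    (z g d : ℕ) (hz : z = Nat.card (Subgroup.center G)) (hg : g = Nat.card (commutator G))
    (hd : d = n / (g * z)) :
    g * z ∣ n ∧
    Nat.card (HopfGaloisStructure.OfType K L G) =
      2 ^ ArithmeticFunction.cardDistinctFactors g * Nat.totient d ∧
    ∃ S : HopfGaloisStructure K L, S.IsOfType G := by
  have hKL : FiniteDimensional K L := Module.finite_of_finrank_pos (by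
    rw [hL]; exact Nat.pos_of_ne_zero hn.ne_zero)
  obtain ⟨D⟩ := MetacyclicData.nonempty_of_squarefree (hG ▸ hn : Squarefree (Nat.card G))
  rw [← hg] at D
  have hfin := D.finite
  obtain ⟨a, ha⟩ := D.exists_gen
  have hm := ha.card_center_mul
  rw [← hz] at hm
  have hnz : n = g * z * Nat.card D.κ.range := by
    rw [mul_assoc, hm, ← hG, D.card_eq]
  have hn0 := hn.ne_zero
  have hdk : d = Nat.card D.κ.range := by
    rw [hd, hnz, Nat.mul_div_cancel_left]
    rw [hnz] at hn0
    exact Nat.pos_of_ne_zero (left_ne_zero_of_mul hn0)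
  -- Descent needs a group in the universe of `L`, where the Hopf algebras live; the finite group
  -- `G` has an isomorphic copy there.
  have hsmall : Small.{v} G := Countable.toSmall G
  let e : Shrink.{v} G ≃* G := Shrink.mulEquiv
  have hcardΓ : Nat.card (L ≃ₐ[K] L) = Nat.card G := by
    rw [IsGalois.card_aut_eq_finrank, hL, hG]
  have hcard : Nat.card (HopfGaloisStructure.OfType K L G) =
      2 ^ ArithmeticFunction.cardDistinctFactors g * Nat.totient d := by
    rw [hdk, ← D.card_quotient hcardΓ]
    exact Nat.card_congr (((IsCocycle.quotientCongr _ e).symm.trans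
      (HopfGaloisStructure.ofTypeEquiv (by rw [Nat.card_congr e.toEquiv, hG, hL]))).trans
      (HopfGaloisStructure.ofTypeCongr e)).symm
  refine ⟨⟨_, hnz⟩, hcard, ?_⟩
  have hpos : 0 < Nat.card (HopfGaloisStructure.OfType K L G) := by
    rw [hcard, hdk]
    have := Nat.totient_pos.2 (Nat.card_pos (α := D.κ.range))
    positivity
  obtain ⟨⟨x⟩⟩ := (Nat.card_pos_iff.1 hpos).1
  exact ⟨x.1, x.2⟩
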